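/- Let $(M,g)$ be a nonempty smooth Riemannian manifold of dimension $n\ge 2$, let $\pi:T^*M\to M$ be its cotangent bundle, and split $TT^*M=VT^*M\oplus HT^*M$ by means of the Levi-Civita connection of $g$. Write $X^H$ for the horizontal lift of a vector $X$, $\alpha^V$ for the vertical lift of a covector $\alpha$, $\flat,\sharp$ for the musical isomorphisms of $g$, and $t=\tfrac12 g^{-1}(p,p)$ for the energy density at $p\in T^*M$. Let $a_1,b_1,a_2,b_2,c_1,d_1,c_2,d_2$ be smooth functions on $[0,\infty)$, and define on $T^*M$ the natural diagonal tensor fields $P$ and $G$ by $$PX^H_p=a_1(t)(X^\flat)^V_p+b_1(t)\,p(X)\,p^V_p,\qquad P\alpha^V_p=a_2(t)(\alpha^\sharp)^H_p+b_2(t)\,g^{-1}(p,\alpha)\,(p^\sharp)^H_p,$$ $$G_p(X^H,Y^H)=c_1(t)g(X,Y)+d_1(t)p(X)p(Y),\quad G_p(\alpha^V,\omega^V)=c_2(t)g^{-1}(\alpha,\omega)+d_2(t)g^{-1}(p,\alpha)g^{-1}(p,\omega),\quad G_p(X^H,\alpha^V)=0.$$ Assume that $(G,P)$ is an almost para-Hermitian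 structure: $G$ is a nondegenerate metric, $P^2=I$ and $G(PX,PY)=-G(X,Y)$. Then there are smooth functions $\lambda,\mu$ on $[0,\infty)$ with $$\frac{c_1}{a_1}=-\frac{c_2}{a_2}=\lambda,\qquad \frac{c_1+2td_1}{a_1+2tb_1}=-\frac{c_2+2td_2}{a_2+2tb_2}=\lambda+2t\mu\qquad(t\ge 0),$$ where no denominator vanishes, and for any such $\lambda,\mu$: 1. $(G,P)$ is para-Kählerian (that is, $P$ is integrable and the $2$-form $\Omega(X,Y)=G(X,PY)$ is closed) if and only if $P$ is a locally product structure (that is, $P^2=I$ and the Nijenhuis tensor field of $P$ vanishes) and $\mu=\lambda'$ on $[0,\infty)$. 2. $P$ is a locally product structure if and only if there is a constant $c$ such that $(M,g)$ has constant sectional curvature $c$ and, for all $t\ge 0$, $$b_1=\frac{a_1a_1'+c}{a_1-2ta_1'},\qquad b_2=\frac{a_1a_2'-a_2^2c}{a_1+2cta_2},$$ where the denominators do not vanish. -/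

import Mathlib

set_option maxSynthPendingDepth 3

open scoped Manifold ContDiff

noncomputable section

namespace ParaKahlerCotangent

open Bundle ContinuousLinearMap

section GeneralManifold

/-! ### Almost product and almost para-Hermitian structures on a smooth manifold `N` -/

variable {F : Type*} [NormedAddCommGroup F] [NormedSpace ℝ F]
  {H : Type*} [TopologicalSpace H] (I : ModelWithCorners ℝ F H)
  {N : Type*} [TopologicalSpace N] [ChartedSpace H N] [IsManifold I 1 N]

/-- The vector field `V` on `N` is smooth near the point `p`. -/
def SmoothFieldAt (V : ∀ p : N, TangentSpace I p) (p : N) : Prop :=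
  ContMDiffAt I I.tangent ∞ (fun q ↦ (⟨q, V q⟩ : TangentBundle I N)) p

/-- The vector field `J V`. -/
def applyField (J : ∀ p : N, TangentSpace I p →L[ℝ] TangentSpace I p)
    (V : ∀ p : N, TangentSpace I p) : ∀ p : N, TangentSpace I p :=
  fun p ↦ J p (V p)

/-- The Nijenhuis field `[JV, JW] - J[JV, W] - J[V, JW] + J²[V, W]` of a `(1, 1)`-tensor field. -/
def nijenhuis (J : ∀ p : N, TangentSpace I p →L[ℝ] TangentSpace I p)
    (V W : ∀ p : N, TangentSpace I p) (p : N) : TangentSpace I p :=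
  VectorField.mlieBracket I (applyField I J V) (applyField I J W) p
    - J p (VectorField.mlieBracket I (applyField I J V) W p)
    - J p (VectorField.mlieBracket I V (applyField I J W) p)
    + J p (J p (VectorField.mlieBracket I V W p))

/-- `J` is an almost product structure: `J² = 1`. -/
def IsAlmostProduct (J : ∀ p : N, TangentSpace I p →L[ℝ] TangentSpace I p) : Prop :=
  ∀ (p : N) (w : TangentSpace I p), J p (J p w) = w

/-- `J` is a locally product structure: an almost product structure which is integrable, that is,
whose Nijenhuis tensor field vanishes. -/
def IsLocallyProduct (J : ∀ p : N, TangentSpace I p →L[ℝ] TangentSpace I p) : Prop :=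
  IsAlmostProduct I J ∧
    ∀ (p : N) (V W : ∀ q : N, TangentSpace I q),
      SmoothFieldAt I V p → SmoothFieldAt I W p → nijenhuis I J V W p = 0

/-- `(G, J)` is an almost para-Hermitian structure: `G` is a pseudo-Riemannian metric (symmetric and
nondegenerate), `J² = 1` and `G(JX, JY) = -G(X, Y)`. -/
structure IsAlmostParaHermitian
    (G : ∀ p : N, TangentSpace I p →L[ℝ] TangentSpace I p →L[ℝ] ℝ)
    (J : ∀ p : N, TangentSpace I p →L[ℝ] TangentSpace I p) : Prop where
  symm : ∀ (p : N) (v w : TangentSpace I p), G p v w = G p w v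
  nondegenerate : ∀ (p : N) (v : TangentSpace I p), (∀ w : TangentSpace I p, G p v w = 0) → v = 0
  almostProduct : IsAlmostProduct I J
  compatible : ∀ (p : N) (v w : TangentSpace I p), G p (J p v) (J p w) = -G p v w

/-- The associated `2`-form `Ω(X, Y) = G(X, JY)`. -/
def associatedForm (G : ∀ p : N, TangentSpace I p →L[ℝ] TangentSpace I p →L[ℝ] ℝ)
    (J : ∀ p : N, TangentSpace I p →L[ℝ] TangentSpace I p)
    (p : N) (v w : TangentSpace I p) : ℝ :=
  G p v (J p w)

/-- The derivative `V f` at `p` of a function `f` along a vector field `V`. -/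
def dirDeriv (V : ∀ p : N, TangentSpace I p) (f : N → ℝ) (p : N) : ℝ :=
  mfderiv I 𝓘(ℝ, ℝ) f p (V p)

/-- The exterior derivative of a `2`-form, evaluated on three vector fields:
`dΨ(U, V, W) = U Ψ(V, W) - V Ψ(U, W) + W Ψ(U, V) - Ψ([U, V], W) + Ψ([U, W], V) - Ψ([V, W], U)`. -/
def extDerivTwoForm (Ψ : ∀ p : N, TangentSpace I p → TangentSpace I p → ℝ)
    (U V W : ∀ p : N, TangentSpace I p) (p : N) : ℝ :=
  dirDeriv I U (fun q ↦ Ψ q (V q) (W q)) p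
    - dirDeriv I V (fun q ↦ Ψ q (U q) (W q)) p
    + dirDeriv I W (fun q ↦ Ψ q (U q) (V q)) p
    - Ψ p (VectorField.mlieBracket I U V p) (W p)
    + Ψ p (VectorField.mlieBracket I U W p) (V p)
    - Ψ p (VectorField.mlieBracket I V W p) (U p)

/-- The `2`-form `Ψ` is closed. -/
def IsClosedTwoForm (Ψ : ∀ p : N, TangentSpace I p → TangentSpace I p → ℝ) : Prop :=
  ∀ (p : N) (U V W : ∀ q : N, TangentSpace I q),
    SmoothFieldAt I U p → SmoothFieldAt I V p → SmoothFieldAt I W p →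
      extDerivTwoForm I Ψ U V W p = 0

/-- `(G, J)` is almost para-Kählerian: almost para-Hermitian with closed associated `2`-form. -/
def IsAlmostParaKahler (G : ∀ p : N, TangentSpace I p →L[ℝ] TangentSpace I p →L[ℝ] ℝ)
    (J : ∀ p : N, TangentSpace I p →L[ℝ] TangentSpace I p) : Prop :=
  IsAlmostParaHermitian I G J ∧ IsClosedTwoForm I (associatedForm I G J)

/-- `(G, J)` is para-Kählerian: almost para-Kählerian, with `J` integrable. -/
def IsParaKahler (G : ∀ p : N, TangentSpace I p →L[ℝ] TangentSpace I p →L[ℝ] ℝ)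
    (J : ∀ p : N, TangentSpace I p →L[ℝ] TangentSpace I p) : Prop :=
  IsAlmostParaKahler I G J ∧ IsLocallyProduct I J

end GeneralManifold

section Base

/-! ### The base: a smooth Riemannian manifold `(M, g)` modelled on `E`

The tangent space `T_x M` is `E`, through the chart at `x`. -/

variable {E : Type*} [NormedAddCommGroup E] [NormedSpace ℝ E]
  {M : Type*} [TopologicalSpace M] [ChartedSpace E M] [IsManifold 𝓘(ℝ, E) ∞ M]

/-- Smooth Riemannian metrics on `M`. -/
abbrev Metric (E : Type*) [NormedAddCommGroup E] [NormedSpace ℝ E]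
    (M : Type*) [TopologicalSpace M] [ChartedSpace E M] [IsManifold 𝓘(ℝ, E) ∞ M] :=
  ContMDiffRiemannianMetric 𝓘(ℝ, E) ∞ E (fun x : M ↦ TangentSpace 𝓘(ℝ, E) x)

/-- `X ↦ X♭`, that is `g_x` itself. -/
def flat (g : Metric E M) (x : M) : E →L[ℝ] E →L[ℝ] ℝ := g.inner x

/-- `α ↦ α♯`, the inverse of `X ↦ X♭`. -/
def sharp (g : Metric E M) (x : M) : (E →L[ℝ] ℝ) →L[ℝ] E := (flat g x).inverse

/-- The metric `g⁻¹(α, β) = α(β♯)` on the cotangent space at `x`. -/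
def cometric (g : Metric E M) (x : M) : (E →L[ℝ] ℝ) →L[ℝ] (E →L[ℝ] ℝ) →L[ℝ] ℝ :=
  (compL ℝ (E →L[ℝ] ℝ) E ℝ).flip (sharp g x)

/-- The differential at `y` of the inverse of the chart of `M` at `x`: it sends the coordinate
vectors to the coordinate vector fields. -/
def chartFrame (x : M) (y : E) :
    E →L[ℝ] TangentSpace 𝓘(ℝ, E) ((extChartAt 𝓘(ℝ, E) x).symm y) :=
  mfderiv 𝓘(ℝ, E) 𝓘(ℝ, E) (extChartAt 𝓘(ℝ, E) x).symm y

/-- The metric in the chart at `x`, at the point with coordinates `y`: the matrix `g_ij(y)` as a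
bilinear form on `E`. -/
def chartMetric (g : Metric E M) (x : M) (y : E) : E →L[ℝ] E →L[ℝ] ℝ :=
  (flat g ((extChartAt 𝓘(ℝ, E) x).symm y)).bilinearComp (chartFrame x y) (chartFrame x y)

/-- Exchanging the arguments of a bilinear form. -/
def flipCLM (E : Type*) [NormedAddCommGroup E] [NormedSpace ℝ E] :
    (E →L[ℝ] E →L[ℝ] ℝ) →L[ℝ] E →L[ℝ] E →L[ℝ] ℝ :=
  (flipₗᵢ ℝ E E ℝ).toContinuousLinearEquiv

/-- The Christoffel symbols of the first kind in the chart at `x`: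
`(u, v, w) ↦ (∂_u g(v, w) + ∂_v g(u, w) - ∂_w g(u, v)) / 2`. -/
def christoffelFirst (g : Metric E M) (x : M) (y : E) : E →L[ℝ] E →L[ℝ] E →L[ℝ] ℝ :=
  (1 / 2 : ℝ) • (fderiv ℝ (chartMetric g x) y + (fderiv ℝ (chartMetric g x) y).flip
    - flipCLM E ∘L (fderiv ℝ (chartMetric g x) y).flip)

/-- The Christoffel symbols `Γ(u, v)` of the Levi-Civita connection in the chart at `x`. -/
def christoffel (g : Metric E M) (x : M) (y : E) : E →L[ℝ] E →L[ℝ] E :=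
  (compL ℝ E (E →L[ℝ] ℝ) E (chartMetric g x y).inverse) ∘L christoffelFirst g x y

/-- The Christoffel symbols at the point `x`, in the chart at `x`. -/
def christoffelAt (g : Metric E M) (x : M) : E →L[ℝ] E →L[ℝ] E :=
  christoffel g x (extChartAt 𝓘(ℝ, E) x x)

/-- The curvature `R(u, v)w` of the Levi-Civita connection at `x`, computed in the chart at `x`. -/
def curvature (g : Metric E M) (x : M) (u v w : E) : E :=
  fderiv ℝ (fun y ↦ christoffel g x y v w) (extChartAt 𝓘(ℝ, E) x x) u
    - fderiv ℝ (fun y ↦ christoffel g x y u w) (extChartAt 𝓘(ℝ, E) x x) v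
    + christoffelAt g x u (christoffelAt g x v w)
    - christoffelAt g x v (christoffelAt g x u w)

/-- All sectional curvatures `g(R(u, v)v, u) / (g(u, u) g(v, v) - g(u, v)²)` are equal to `c`. -/
def HasConstantSectionalCurvature (g : Metric E M) (c : ℝ) : Prop :=
  ∀ (x : M) (u v : E), flat g x (curvature g x u v v) u =
    c * (flat g x u u * flat g x v v - flat g x u v ^ 2)

end Base

section Cotangent

/-! ### Natural diagonal lifts to the cotangent bundle

Mathlib's chart of `T*M` at `p`, with `π(p) = x`, is the chart `(q, p)` induced by the chart of `M`
at `x`. Hence `T_p(T*M)` is `E × E*`, the pair `(u, β)` standing for `uⁱ ∂/∂qⁱ + β_i ∂/∂p_i`. -/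

variable {E : Type*} [NormedAddCommGroup E] [NormedSpace ℝ E]
  {M : Type*} [TopologicalSpace M] [ChartedSpace E M] [IsManifold 𝓘(ℝ, E) ∞ M]

/-- The total space `T*M` of the cotangent bundle. -/
abbrev CotangentBundle (E : Type*) [NormedAddCommGroup E] [NormedSpace ℝ E]
    (M : Type*) [TopologicalSpace M] [ChartedSpace E M] [IsManifold 𝓘(ℝ, E) ∞ M] :=
  TotalSpace (E →L[ℝ] ℝ) (fun x : M ↦ TangentSpace 𝓘(ℝ, E) x →L[ℝ] Trivial M ℝ x)

/-- The model with corners of `T*M`. -/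
abbrev cotangentModel (E : Type*) [NormedAddCommGroup E] [NormedSpace ℝ E] :
    ModelWithCorners ℝ (E × (E →L[ℝ] ℝ)) (ModelProd E (E →L[ℝ] ℝ)) :=
  𝓘(ℝ, E).prod 𝓘(ℝ, E →L[ℝ] ℝ)

/-- The covector `p ∈ T*_x M`. -/
def covector (p : CotangentBundle E M) : E →L[ℝ] ℝ := p.snd

/-- The energy density `t = g⁻¹(p, p) / 2`. -/
def energy (g : Metric E M) (p : CotangentBundle E M) : ℝ :=
  (1 / 2 : ℝ) * cometric g p.proj (covector p) (covector p)

/-- `u ↦ p(Γ(u, ·))`, that is `uⁱ ↦ p_k Γᵏ_{ih} uⁱ`. -/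
def connectionForm (g : Metric E M) (p : CotangentBundle E M) : E →L[ℝ] E →L[ℝ] ℝ :=
  (compL ℝ E E ℝ (covector p)) ∘L christoffelAt g p.proj

/-- The horizontal lift `X ↦ X^H_p`: it sends `∂/∂xⁱ` to
`δ/δqⁱ = ∂/∂qⁱ + p_k Γᵏ_{ih} ∂/∂p_h`. -/
def hlift (g : Metric E M) (p : CotangentBundle E M) :
    E →L[ℝ] E × (E →L[ℝ] ℝ) :=
  (ContinuousLinearMap.id ℝ E).prod (connectionForm g p)

/-- The vertical lift `α ↦ α^V_p`: it sends `dxⁱ` to `∂/∂p_i`. -/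
def vlift (_p : CotangentBundle E M) : (E →L[ℝ] ℝ) →L[ℝ] E × (E →L[ℝ] ℝ) :=
  inr ℝ E (E →L[ℝ] ℝ)

/-- The projection `π_*` of a tangent vector of `T*M`: `X^H ↦ X`, `α^V ↦ 0`. -/
def hpart (_p : CotangentBundle E M) : E × (E →L[ℝ] ℝ) →L[ℝ] E :=
  fst ℝ E (E →L[ℝ] ℝ)

/-- The vertical component of a tangent vector of `T*M`: `X^H ↦ 0`, `α^V ↦ α`. -/
def vpart (g : Metric E M) (p : CotangentBundle E M) :
    E × (E →L[ℝ] ℝ) →L[ℝ] E →L[ℝ] ℝ :=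
  snd ℝ E (E →L[ℝ] ℝ) - connectionForm g p ∘L fst ℝ E (E →L[ℝ] ℝ)

/-- The natural diagonal `(1, 1)`-tensor field
`P X^H = a₁(t) (X♭)^V + b₁(t) p(X) p^V`, `P α^V = a₂(t) (α♯)^H + b₂(t) g⁻¹(p, α) (p♯)^H`. -/
def naturalTensor (g : Metric E M) (a₁ b₁ a₂ b₂ : ℝ → ℝ) (p : CotangentBundle E M) :
    TangentSpace (cotangentModel E) p →L[ℝ] TangentSpace (cotangentModel E) p :=
  vlift p ∘L (a₁ (energy g p) • flat g p.proj
      + b₁ (energy g p) • (covector p).smulRight (covector p)) ∘L hpart p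
  + hlift g p ∘L (a₂ (energy g p) • sharp g p.proj
      + b₂ (energy g p) •
        (cometric g p.proj (covector p)).smulRight (sharp g p.proj (covector p))) ∘L vpart g p

/-- The natural diagonal metric
`G(X^H, Y^H) = c₁(t) g(X, Y) + d₁(t) p(X) p(Y)`,
`G(α^V, ω^V) = c₂(t) g⁻¹(α, ω) + d₂(t) g⁻¹(p, α) g⁻¹(p, ω)`, `G(X^H, α^V) = 0`. -/
def naturalMetric (g : Metric E M) (c₁ d₁ c₂ d₂ : ℝ → ℝ) (p : CotangentBundle E M) :
    TangentSpace (cotangentModel E) p →L[ℝ] TangentSpace (cotangentModel E) p →L[ℝ] ℝ :=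
  (c₁ (energy g p) • flat g p.proj
      + d₁ (energy g p) • (covector p).smulRight (covector p)).bilinearComp (hpart p) (hpart p)
  + (c₂ (energy g p) • cometric g p.proj
      + d₂ (energy g p) •
        (cometric g p.proj (covector p)).smulRight (cometric g p.proj (covector p))).bilinearComp
          (vpart g p) (vpart g p)

end Cotangent

section Coefficients

/-! ### Relations between coefficients, which are functions of the energy density `t ∈ [0, ∞)` -/

/-- A smooth function on `[0, ∞)`. -/
def SmoothCoeff (f : ℝ → ℝ) : Prop := ContDiffOn ℝ ∞ f (Set.Ici 0)

/-- The derivative of a function on `[0, ∞)`, one-sided at `0`. -/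
def coeffDeriv (f : ℝ → ℝ) (t : ℝ) : ℝ := derivWithin f (Set.Ici 0) t

/-- `lam` and `mu` are the smooth proportionality factors of the coefficients of `G` and `P`:
`c₁ / a₁ = -c₂ / a₂ = λ` and
`(c₁ + 2t d₁) / (a₁ + 2t b₁) = -(c₂ + 2t d₂) / (a₂ + 2t b₂) = λ + 2t μ`. -/
structure AreProportionalityFactors (a₁ b₁ a₂ b₂ c₁ d₁ c₂ d₂ lam mu : ℝ → ℝ) : Prop where
  smooth_lam : SmoothCoeff lam
  smooth_mu : SmoothCoeff mu
  ne_zero : ∀ t, 0 ≤ t →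
    a₁ t ≠ 0 ∧ a₂ t ≠ 0 ∧ a₁ t + 2 * t * b₁ t ≠ 0 ∧ a₂ t + 2 * t * b₂ t ≠ 0
  first : ∀ t, 0 ≤ t → c₁ t / a₁ t = lam t ∧ -(c₂ t / a₂ t) = lam t
  second : ∀ t, 0 ≤ t →
    (c₁ t + 2 * t * d₁ t) / (a₁ t + 2 * t * b₁ t) = lam t + 2 * t * mu t ∧
    -((c₂ t + 2 * t * d₂ t) / (a₂ t + 2 * t * b₂ t)) = lam t + 2 * t * mu t

/-- `b₁ = (a₁ a₁' + c) / (a₁ - 2t a₁')` and `b₂ = (a₁ a₂' - a₂² c) / (a₁ + 2c t a₂)` on `[0, ∞)`,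
where the denominators have no zeros. -/
def IntegrabilityRelations (a₁ b₁ a₂ b₂ : ℝ → ℝ) (c : ℝ) : Prop :=
  ∀ t, 0 ≤ t →
    a₁ t - 2 * t * coeffDeriv a₁ t ≠ 0 ∧ a₁ t + 2 * c * t * a₂ t ≠ 0 ∧
    b₁ t = (a₁ t * coeffDeriv a₁ t + c) / (a₁ t - 2 * t * coeffDeriv a₁ t) ∧
    b₂ t = (a₁ t * coeffDeriv a₂ t - a₂ t ^ 2 * c) / (a₁ t + 2 * c * t * a₂ t)

end Coefficients

end ParaKahlerCotangent

end

open ParaKahlerCotangent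

/-!
In the coordinates of `T*M` induced by a chart of `M`, the naturality of the Levi-Civita connection
turns `P` into an explicit field of endomorphisms, which exchanges the horizontal lifts
`u ↦ (u, ξ(Γ(u, ·)))` with the vertical covectors. As `P² = 1`, the Nijenhuis tensor is determined
by its values on horizontal lifts, where it is the vertical covector
`ξ ∘ R(u, v) - (a₁ b₁ - a₁'(a₁ + 2t b₁)) (ξ(u) v♭ - ξ(v) u♭)`. It therefore vanishes if and only if
the curvature is constant and equal to this coefficient, a linear equation for `b₁` whose solution
is the formula of the theorem; the formula for `b₂` follows from `P² = 1`.

Compatibility of `G` with `P` makes the associated form equal to `λ ω + μ θ ∧ dt`, where `θ` is the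
Liouville form and `ω = -dθ`. Its differential is `(λ' - μ) dt ∧ ω`, and `dt ∧ ω ≠ 0` away from the
zero section, since the dimension is at least two. Both identities between coefficients extend to
`t = 0` by continuity.
-/

noncomputable section

namespace ParaKahlerCotangent

open Bundle ContinuousLinearMap Filter Topology VectorField

section VectorSpace

variable {F : Type*} [NormedAddCommGroup F] [NormedSpace ℝ F]

/-- The Nijenhuis tensor at `z` of a field of endomorphisms of a vector space, expressed through the
derivative of the field. -/
def coordNijenhuis (J : F → F →L[ℝ] F) (z v w : F) : F :=
  fderiv ℝ J z (J z v) w - fderiv ℝ J z (J z w) v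
    + J z (fderiv ℝ J z w v) - J z (fderiv ℝ J z v w)

/-- The exterior derivative at `z` of a field of bilinear forms on a vector space; it is meant for
alternating forms. -/
def coordExtDeriv (Ψ : F → F →L[ℝ] F →L[ℝ] ℝ) (z u v w : F) : ℝ :=
  fderiv ℝ Ψ z u v w - fderiv ℝ Ψ z v u w + fderiv ℝ Ψ z w u v

theorem lieBracket_nijenhuis_eq {J : F → F →L[ℝ] F} {V W : F → F} {z : F}
    (hJ : DifferentiableAt ℝ J z) (hV : DifferentiableAt ℝ V z) (hW : DifferentiableAt ℝ W z) :
    lieBracket ℝ (fun y ↦ J y (V y)) (fun y ↦ J y (W y)) z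
      - J z (lieBracket ℝ (fun y ↦ J y (V y)) W z)
      - J z (lieBracket ℝ V (fun y ↦ J y (W y)) z)
      + J z (J z (lieBracket ℝ V W z)) = coordNijenhuis J z (V z) (W z) := by
  simp only [lieBracket, coordNijenhuis, fderiv_clm_apply hJ hV, fderiv_clm_apply hJ hW, add_apply,
    ContinuousLinearMap.comp_apply, ContinuousLinearMap.flip_apply, map_sub, map_add]
  abel

theorem fderiv_bilinear_apply {G : Type*} [NormedAddCommGroup G] [NormedSpace ℝ G]
    {Ψ : F → F →L[ℝ] F →L[ℝ] G} {V W : F → F} {z : F}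
    (hΨ : DifferentiableAt ℝ Ψ z) (hV : DifferentiableAt ℝ V z) (hW : DifferentiableAt ℝ W z)
    (u : F) :
    fderiv ℝ (fun y ↦ Ψ y (V y) (W y)) z u =
      fderiv ℝ Ψ z u (V z) (W z) + Ψ z (fderiv ℝ V z u) (W z) + Ψ z (V z) (fderiv ℝ W z u) := by
  simp only [fderiv_clm_apply (hΨ.clm_apply hV) hW, fderiv_clm_apply hΨ hV, add_apply,
    ContinuousLinearMap.comp_apply, ContinuousLinearMap.flip_apply]
  abel

theorem lieBracket_extDeriv_eq {Ψ : F → F →L[ℝ] F →L[ℝ] ℝ} {U V W : F → F} {z : F}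
    (hΨ : DifferentiableAt ℝ Ψ z) (hanti : ∀ v w, Ψ z v w = -Ψ z w v)
    (hU : DifferentiableAt ℝ U z) (hV : DifferentiableAt ℝ V z) (hW : DifferentiableAt ℝ W z) :
    fderiv ℝ (fun y ↦ Ψ y (V y) (W y)) z (U z) - fderiv ℝ (fun y ↦ Ψ y (U y) (W y)) z (V z)
      + fderiv ℝ (fun y ↦ Ψ y (U y) (V y)) z (W z)
      - Ψ z (lieBracket ℝ U V z) (W z) + Ψ z (lieBracket ℝ U W z) (V z)
      - Ψ z (lieBracket ℝ V W z) (U z) = coordExtDeriv Ψ z (U z) (V z) (W z) := by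
  simp only [lieBracket, coordExtDeriv, fderiv_bilinear_apply hΨ hV hW,
    fderiv_bilinear_apply hΨ hU hW, fderiv_bilinear_apply hΨ hU hV, map_sub, sub_apply]
  rw [hanti (V z), hanti (U z) (fderiv ℝ W z (V z)), hanti (U z) (fderiv ℝ V z (W z))]
  ring

end VectorSpace

section Coordinates

variable {F : Type*} [NormedAddCommGroup F] [NormedSpace ℝ F]
  {H : Type*} [TopologicalSpace H] (I : ModelWithCorners ℝ F H)
  {N : Type*} [TopologicalSpace N] [ChartedSpace H N]

/-- The coordinate frame at `z` of the chart at `p`, that is the differential at `z` of the inverse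
chart. It is typed as an endomorphism of the model space, which every tangent space is by
definition. -/
def coordFrame (p : N) (z : F) : F →L[ℝ] F :=
  mfderiv 𝓘(ℝ, F) I (extChartAt I p).symm z

/-- A vector field, read in the chart at `p`. -/
def coordField (p : N) (V : ∀ q : N, TangentSpace I q) (z : F) : F :=
  (coordFrame I p z).inverse (V ((extChartAt I p).symm z))

/-- The change of coordinates from the chart at `p` to the chart at `q`. -/
def coordTransition (p q : N) : F → F := extChartAt I q ∘ (extChartAt I p).symm

/-- The domain of `coordTransition I p q`, in the coordinates of the chart at `p`. -/
def coordOverlap (p q : N) : Set F :=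
  (extChartAt I p).target ∩ (extChartAt I p).symm ⁻¹' (extChartAt I q).source

/-- `Jc` is the expression, in the chart at `p` and near `p`, of the `(1, 1)`-tensor field `J`. -/
def IsCoordTensor (p : N) (J : ∀ q : N, TangentSpace I q →L[ℝ] TangentSpace I q)
    (Jc : F → F →L[ℝ] F) : Prop :=
  ∀ᶠ z in 𝓝 (extChartAt I p p), ∀ v : F,
    coordFrame I p z (Jc z v) = J ((extChartAt I p).symm z) (coordFrame I p z v)

/-- `Ψc` is the expression, in the chart at `p` and near `p`, of the `2`-form `Ψ`. -/
def IsCoordForm (p : N) (Ψ : ∀ q : N, TangentSpace I q → TangentSpace I q → ℝ)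
    (Ψc : F → F →L[ℝ] F →L[ℝ] ℝ) : Prop :=
  ∀ᶠ z in 𝓝 (extChartAt I p p), ∀ v w : F,
    Ψ ((extChartAt I p).symm z) (coordFrame I p z v) (coordFrame I p z w) = Ψc z v w

theorem coordTransition_self (p q : N) :
    coordTransition I p q (extChartAt I p p) = extChartAt I q p := by
  rw [coordTransition, Function.comp_apply, extChartAt_to_inv]

variable {I}

theorem extChartAt_symm_coordTransition {p q : N} {z : F} (hz : z ∈ coordOverlap I p q) :
    (extChartAt I q).symm (coordTransition I p q z) = (extChartAt I p).symm z :=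
  (extChartAt I q).left_inv hz.2

theorem coordTransition_coordTransition {p q : N} {z : F} (hz : z ∈ coordOverlap I p q) :
    coordTransition I q p (coordTransition I p q z) = z := by
  rw [coordTransition, Function.comp_apply, extChartAt_symm_coordTransition hz,
    (extChartAt I p).right_inv hz.1]

theorem coordTransition_mem_coordOverlap {p q : N} {z : F} (hz : z ∈ coordOverlap I p q) :
    coordTransition I p q z ∈ coordOverlap I q p := by
  refine ⟨(extChartAt I q).map_source hz.2, ?_⟩
  rw [Set.mem_preimage, extChartAt_symm_coordTransition hz]
  exact (extChartAt I p).map_target hz.1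

theorem extChartAt_self_mem_coordOverlap {p q : N} (hp : p ∈ (extChartAt I q).source) :
    extChartAt I p p ∈ coordOverlap I p q :=
  ⟨mem_extChartAt_target p, by rwa [Set.mem_preimage, extChartAt_to_inv]⟩

theorem dirDeriv_eq_fderiv [IsManifold I 1 N] {p : N} {f : N → ℝ} {fc : F → ℝ}
    (hf : DifferentiableAt ℝ fc (extChartAt I p p))
    (hfc : ∀ᶠ z in 𝓝 (extChartAt I p p), f ((extChartAt I p).symm z) = fc z)
    (U : ∀ q : N, TangentSpace I q) :
    dirDeriv I U f p = fderiv ℝ fc (extChartAt I p p) (U p) := by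
  have hcomp : f =ᶠ[𝓝 p] fc ∘ extChartAt I p := by
    filter_upwards [(continuousAt_extChartAt (I := I) p).eventually hfc,
      extChartAt_source_mem_nhds (I := I) p] with q hq hqs
    rw [Function.comp_apply, ← hq, (extChartAt I p).left_inv hqs]
  unfold dirDeriv
  rw [hcomp.mfderiv_eq, mfderiv_comp p hf.mdifferentiableAt
    (mdifferentiableAt_extChartAt (mem_chart_source H p)), mfderiv_extChartAt_self,
    mfderiv_eq_fderiv]
  rfl

theorem exists_smoothFieldAt [IsManifold I ∞ N] [CompleteSpace F] (p : N) (v : F) :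
    ∃ V : ∀ q : N, TangentSpace I q, SmoothFieldAt I V p ∧ V p = v := by
  have hid : (mfderiv I 𝓘(ℝ, F) (extChartAt I p) p : F →L[ℝ] F) = .id ℝ F :=
    mfderiv_extChartAt_self
  refine ⟨mpullback I 𝓘(ℝ, F) (extChartAt I p) fun _ ↦ v, ?_, ?_⟩
  · refine ContMDiffAt.mpullback_vectorField_preimage (n := ∞) (m := ∞)
      (contMDiffAt_vectorSpace_iff_contDiffAt.2 contDiffAt_const) contMDiffAt_extChartAt ?_
      (by norm_cast)
    rw [mfderiv_extChartAt_self]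
    exact ⟨ContinuousLinearEquiv.refl ℝ F, rfl⟩
  · refine (congrArg (fun L : F →L[ℝ] F ↦ L.inverse v) hid).trans ?_
    rw [ContinuousLinearMap.inverse_id, ContinuousLinearMap.id_apply]

variable [I.Boundaryless]

theorem isOpen_coordOverlap (p q : N) : IsOpen (coordOverlap I p q) :=
  (continuousOn_extChartAt_symm p).isOpen_inter_preimage (isOpen_extChartAt_target p)
    (isOpen_extChartAt_source q)

theorem contDiffAt_coordTransition [IsManifold I ∞ N] {p q : N} {z : F}
    (hz : z ∈ coordOverlap I p q) : ContDiffAt ℝ ∞ (coordTransition I p q) z := by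
  have := contDiffWithinAt_ext_coord_change (n := ∞) q p hz
  rwa [I.range_eq_univ, contDiffWithinAt_univ] at this

section

variable [IsManifold I 1 N]

theorem isInvertible_coordFrame {p : N} {z : F} (hz : z ∈ (extChartAt I p).target) :
    (coordFrame I p z).IsInvertible := by
  have := isInvertible_mfderivWithin_extChartAt_symm (I := I) hz
  rwa [I.range_eq_univ, mfderivWithin_univ] at this

variable (I) in
theorem coordFrame_self (p : N) : coordFrame I p (extChartAt I p p) = .id ℝ F := by
  have := mfderivWithin_range_extChartAt_symm (I := I) (x := p)
  rwa [I.range_eq_univ, mfderivWithin_univ] at this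

theorem mdifferentiableAt_extChartAt_symm {p : N} {z : F} (hz : z ∈ (extChartAt I p).target) :
    MDifferentiableAt 𝓘(ℝ, F) I (extChartAt I p).symm z := by
  have := mdifferentiableWithinAt_extChartAt_symm (I := I) hz
  rwa [I.range_eq_univ, mdifferentiableWithinAt_univ] at this

theorem coordFrame_coordField {p : N} {z : F} (hz : z ∈ (extChartAt I p).target)
    (V : ∀ q : N, TangentSpace I q) :
    coordFrame I p z (coordField I p V z) = V ((extChartAt I p).symm z) :=
  (isInvertible_coordFrame hz).self_apply_inverse _

theorem coordField_eq_iff {p : N} {z v : F} (hz : z ∈ (extChartAt I p).target)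
    {V : ∀ q : N, TangentSpace I q} :
    coordField I p V z = v ↔ V ((extChartAt I p).symm z) = coordFrame I p z v :=
  (isInvertible_coordFrame hz).inverse_apply_eq

variable (I) in
theorem coordField_self (p : N) (V : ∀ q : N, TangentSpace I q) :
    coordField I p V (extChartAt I p p) = V p := by
  refine (coordField_eq_iff (mem_extChartAt_target p)).2 ?_
  rw [coordFrame_self, extChartAt_to_inv]
  rfl

theorem IsCoordTensor.apply_self {p : N} {J : ∀ q : N, TangentSpace I q →L[ℝ] TangentSpace I q}
    {Jc : F → F →L[ℝ] F} (hJ : IsCoordTensor I p J Jc) (v : F) :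
    J p v = Jc (extChartAt I p p) v := by
  have h := hJ.self_of_nhds v
  rw [coordFrame_self, extChartAt_to_inv] at h
  exact h.symm

theorem IsCoordForm.apply_self {p : N} {Ψ : ∀ q : N, TangentSpace I q → TangentSpace I q → ℝ}
    {Ψc : F → F →L[ℝ] F →L[ℝ] ℝ} (hΨ : IsCoordForm I p Ψ Ψc) (v w : TangentSpace I p) :
    Ψ p v w = Ψc (extChartAt I p p) v w := by
  have h := hΨ.self_of_nhds v w
  rw [coordFrame_self, extChartAt_to_inv] at h
  exact h

theorem IsCoordTensor.coordField_applyField {p : N}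
    {J : ∀ q : N, TangentSpace I q →L[ℝ] TangentSpace I q} {Jc : F → F →L[ℝ] F}
    (hJ : IsCoordTensor I p J Jc) (V : ∀ q : N, TangentSpace I q) :
    coordField I p (applyField I J V) =ᶠ[𝓝 (extChartAt I p p)]
      fun z ↦ Jc z (coordField I p V z) := by
  filter_upwards [hJ, extChartAt_target_mem_nhds (I := I) p] with z hz hzt
  rw [coordField_eq_iff hzt, hz, coordFrame_coordField hzt]
  rfl

theorem IsCoordTensor.eventually_apply_apply {p : N}
    {J : ∀ q : N, TangentSpace I q →L[ℝ] TangentSpace I q} {Jc : F → F →L[ℝ] F}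
    (hJ : IsCoordTensor I p J Jc) (hJJ : IsAlmostProduct I J) :
    ∀ᶠ z in 𝓝 (extChartAt I p p), ∀ v : F, Jc z (Jc z v) = v := by
  filter_upwards [hJ, extChartAt_target_mem_nhds (I := I) p] with z hz hzt v
  refine (isInvertible_coordFrame hzt).injective ?_
  exact (hz _).trans ((congrArg _ (hz v)).trans (hJJ _ _))

theorem IsCoordForm.apply_coordField {p : N}
    {Ψ : ∀ q : N, TangentSpace I q → TangentSpace I q → ℝ} {Ψc : F → F →L[ℝ] F →L[ℝ] ℝ}
    (hΨ : IsCoordForm I p Ψ Ψc) (V W : ∀ q : N, TangentSpace I q) :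
    ∀ᶠ z in 𝓝 (extChartAt I p p),
      (fun q ↦ Ψ q (V q) (W q)) ((extChartAt I p).symm z) =
        Ψc z (coordField I p V z) (coordField I p W z) := by
  filter_upwards [hΨ, extChartAt_target_mem_nhds (I := I) p] with z hz hzt
  rw [← hz, coordFrame_coordField hzt, coordFrame_coordField hzt]

end

variable [IsManifold I ∞ N]

theorem coordFrame_eq_comp_fderiv {p q : N} {z : F} (hz : z ∈ coordOverlap I p q) :
    coordFrame I p z =
      coordFrame I q (coordTransition I p q z) ∘L fderiv ℝ (coordTransition I p q) z := by
  have hfactor : (extChartAt I p).symm =ᶠ[𝓝 z] (extChartAt I q).symm ∘ coordTransition I p q := by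
    filter_upwards [(isOpen_coordOverlap p q).mem_nhds hz] with z' hz'
    exact (extChartAt_symm_coordTransition hz').symm
  have hτ := (contDiffAt_coordTransition hz).differentiableAt (by simp)
  have hq := mdifferentiableAt_extChartAt_symm (coordTransition_mem_coordOverlap hz).1
  have hcomp := mfderiv_comp z hq hτ.mdifferentiableAt
  rw [mfderiv_eq_fderiv] at hcomp
  exact hfactor.mfderiv_eq.trans hcomp

theorem coordFrame_eq_fderiv {p q : N} {z : F} (hz : z ∈ (extChartAt I p).target)
    (hq : (extChartAt I p).symm z = q) :
    coordFrame I p z = fderiv ℝ (coordTransition I p q) z := by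
  subst hq
  rw [coordFrame_eq_comp_fderiv ⟨hz, mem_extChartAt_source _⟩]
  exact congrArg (· ∘L _) (coordFrame_self I _)

theorem inverse_coordFrame {p q : N} {z : F} (hz : z ∈ (extChartAt I p).target)
    (hq : (extChartAt I p).symm z = q) :
    (coordFrame I p z).inverse = fderiv ℝ (coordTransition I q p) (extChartAt I q q) := by
  subst hq
  have hcomp := coordFrame_eq_comp_fderiv
    (extChartAt_self_mem_coordOverlap ((extChartAt I p).map_target hz))
  rw [coordFrame_self, coordTransition_self, (extChartAt I p).right_inv hz] at hcomp
  ext v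
  exact (isInvertible_coordFrame hz).inverse_apply_eq.2
    (congrArg (fun L : F →L[ℝ] F ↦ L v) hcomp)

theorem mlieBracket_eq_lieBracket (p : N) (V W : ∀ q : N, TangentSpace I q) :
    mlieBracket I V W p =
      lieBracket ℝ (coordField I p V) (coordField I p W) (extChartAt I p p) := by
  rw [← mlieBracketWithin_univ, mlieBracketWithin_apply, mfderiv_extChartAt_self,
    I.range_eq_univ, Set.preimage_univ, Set.univ_inter, mpullbackWithin_univ,
    mpullbackWithin_univ]
  change (ContinuousLinearMap.id ℝ F).inverse
    (lieBracketWithin ℝ (coordField I p V) (coordField I p W) Set.univ (extChartAt I p p)) = _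
  rw [ContinuousLinearMap.inverse_id, lieBracketWithin_univ, ContinuousLinearMap.id_apply]

variable [CompleteSpace F] {p : N}

theorem SmoothFieldAt.differentiableAt_coordField {V : ∀ q : N, TangentSpace I q}
    (hV : SmoothFieldAt I V p) : DifferentiableAt ℝ (coordField I p V) (extChartAt I p p) := by
  have h := contMDiffWithinAt_mpullbackWithin_extChartAt_symm (n := ∞) (m := 1)
    (hV.of_le (mod_cast le_top)).contMDiffWithinAt uniqueMDiffOn_univ
    (Set.mem_univ p) (by norm_cast)
  rw [contMDiffWithinAt_vectorSpace_iff_contDiffWithinAt, I.range_eq_univ, Set.preimage_univ,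
    Set.inter_univ, mpullbackWithin_univ] at h
  exact (h.contDiffAt (extChartAt_target_mem_nhds p)).differentiableAt one_ne_zero

section Nijenhuis

variable {J : ∀ q : N, TangentSpace I q →L[ℝ] TangentSpace I q} {Jc : F → F →L[ℝ] F}

theorem nijenhuis_eq_coordNijenhuis (hJc : DifferentiableAt ℝ Jc (extChartAt I p p))
    (hJ : IsCoordTensor I p J Jc) {V W : ∀ q : N, TangentSpace I q}
    (hV : SmoothFieldAt I V p) (hW : SmoothFieldAt I W p) :
    nijenhuis I J V W p = coordNijenhuis Jc (extChartAt I p p) (V p) (W p) := by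
  have hflat := lieBracket_nijenhuis_eq hJc hV.differentiableAt_coordField
    hW.differentiableAt_coordField
  have hJV := hJ.coordField_applyField V
  have hJW := hJ.coordField_applyField W
  rw [coordField_self, coordField_self] at hflat
  rw [← hflat]
  unfold nijenhuis
  rw [mlieBracket_eq_lieBracket, mlieBracket_eq_lieBracket, mlieBracket_eq_lieBracket,
    mlieBracket_eq_lieBracket, hJV.lieBracket_vectorField_eq hJW,
    hJV.lieBracket_vectorField_eq EventuallyEq.rfl, EventuallyEq.rfl.lieBracket_vectorField_eq hJW]
  simp only [hJ.apply_self]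
  rfl

theorem nijenhuis_eq_zero_iff (hJc : DifferentiableAt ℝ Jc (extChartAt I p p))
    (hJ : IsCoordTensor I p J Jc) :
    (∀ V W : ∀ q : N, TangentSpace I q, SmoothFieldAt I V p → SmoothFieldAt I W p →
      nijenhuis I J V W p = 0) ↔ ∀ v w : F, coordNijenhuis Jc (extChartAt I p p) v w = 0 := by
  constructor
  · intro h v w
    obtain ⟨V, hV, rfl⟩ := exists_smoothFieldAt (I := I) p v
    obtain ⟨W, hW, rfl⟩ := exists_smoothFieldAt (I := I) p w
    exact (nijenhuis_eq_coordNijenhuis hJc hJ hV hW).symm.trans (h V W hV hW)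
  · intro h V W hV hW
    exact (nijenhuis_eq_coordNijenhuis hJc hJ hV hW).trans (h _ _)

end Nijenhuis

section ExtDeriv

variable {Ψ : ∀ q : N, TangentSpace I q → TangentSpace I q → ℝ} {Ψc : F → F →L[ℝ] F →L[ℝ] ℝ}

theorem extDerivTwoForm_eq_coordExtDeriv (hΨc : DifferentiableAt ℝ Ψc (extChartAt I p p))
    (hanti : ∀ v w, Ψc (extChartAt I p p) v w = -Ψc (extChartAt I p p) w v)
    (hΨ : IsCoordForm I p Ψ Ψc) {U V W : ∀ q : N, TangentSpace I q}
    (hU : SmoothFieldAt I U p) (hV : SmoothFieldAt I V p) (hW : SmoothFieldAt I W p) :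
    extDerivTwoForm I Ψ U V W p = coordExtDeriv Ψc (extChartAt I p p) (U p) (V p) (W p) := by
  have dU := hU.differentiableAt_coordField
  have dV := hV.differentiableAt_coordField
  have dW := hW.differentiableAt_coordField
  have hflat := lieBracket_extDeriv_eq hΨc hanti dU dV dW
  simp only [coordField_self] at hflat
  rw [← hflat]
  unfold extDerivTwoForm
  rw [hΨ.apply_self (mlieBracket I U V p), hΨ.apply_self (mlieBracket I U W p),
    hΨ.apply_self (mlieBracket I V W p),
    dirDeriv_eq_fderiv ((hΨc.clm_apply dV).clm_apply dW) (hΨ.apply_coordField V W),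
    dirDeriv_eq_fderiv ((hΨc.clm_apply dU).clm_apply dW) (hΨ.apply_coordField U W),
    dirDeriv_eq_fderiv ((hΨc.clm_apply dU).clm_apply dV) (hΨ.apply_coordField U V),
    mlieBracket_eq_lieBracket, mlieBracket_eq_lieBracket, mlieBracket_eq_lieBracket]

theorem extDerivTwoForm_eq_zero_iff (hΨc : DifferentiableAt ℝ Ψc (extChartAt I p p))
    (hanti : ∀ v w, Ψc (extChartAt I p p) v w = -Ψc (extChartAt I p p) w v)
    (hΨ : IsCoordForm I p Ψ Ψc) :
    (∀ U V W : ∀ q : N, TangentSpace I q, SmoothFieldAt I U p → SmoothFieldAt I V p →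
      SmoothFieldAt I W p → extDerivTwoForm I Ψ U V W p = 0) ↔
      ∀ u v w : F, coordExtDeriv Ψc (extChartAt I p p) u v w = 0 := by
  constructor
  · intro h u v w
    obtain ⟨U, hU, rfl⟩ := exists_smoothFieldAt (I := I) p u
    obtain ⟨V, hV, rfl⟩ := exists_smoothFieldAt (I := I) p v
    obtain ⟨W, hW, rfl⟩ := exists_smoothFieldAt (I := I) p w
    exact (extDerivTwoForm_eq_coordExtDeriv hΨc hanti hΨ hU hV hW).symm.trans (h U V W hU hV hW)
  · intro h U V W hU hV hW
    exact (extDerivTwoForm_eq_coordExtDeriv hΨc hanti hΨ hU hV hW).trans (h _ _ _)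

end ExtDeriv

end Coordinates

section LinearAlgebra

variable {E : Type*} [NormedAddCommGroup E] [NormedSpace ℝ E]

/-- A positive definite symmetric bilinear form. -/
structure IsInner (h : E →L[ℝ] E →L[ℝ] ℝ) : Prop where
  symm : ∀ v w, h v w = h w v
  pos : ∀ v, v ≠ 0 → 0 < h v v

/-- Half of the squared length of a covector, for the metric `h⁻¹`. -/
def halfSq (h : E →L[ℝ] E →L[ℝ] ℝ) (ξ : E →L[ℝ] ℝ) : ℝ := (1 / 2 : ℝ) * ξ (h.inverse ξ)

namespace IsInner

variable {h : E →L[ℝ] E →L[ℝ] ℝ} (hh : IsInner h)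
include hh

theorem eq_zero_of_forall {v : E} (hv : ∀ w, h v w = 0) : v = 0 :=
  by_contra fun hne ↦ (hh.pos v hne).ne' (hv v)

theorem nonneg (v : E) : 0 ≤ h v v := by
  obtain rfl | hv := eq_or_ne v 0
  · rw [map_zero]
  · exact (hh.pos v hv).le

variable [FiniteDimensional ℝ E]

theorem isInvertible : h.IsInvertible := by
  have hinj : Function.Injective h := (injective_iff_map_eq_zero h).2 fun v hv ↦
    hh.eq_zero_of_forall fun w ↦ by rw [hv, zero_apply]
  have hdim : Module.finrank ℝ E = Module.finrank ℝ (E →L[ℝ] ℝ) := by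
    rw [← (LinearMap.toContinuousLinearMap : (E →ₗ[ℝ] ℝ) ≃ₗ[ℝ] E →L[ℝ] ℝ).finrank_eq]
    exact Subspace.dual_finrank_eq.symm
  exact ⟨(LinearEquiv.ofInjectiveOfFinrankEq h.toLinearMap hinj hdim).toContinuousLinearEquiv, rfl⟩

theorem apply_inverse (ξ : E →L[ℝ] ℝ) : h (h.inverse ξ) = ξ :=
  hh.isInvertible.self_apply_inverse ξ

theorem inverse_apply (v : E) : h.inverse (h v) = v :=
  hh.isInvertible.inverse_apply_self v

theorem apply_inverse_symm (ξ η : E →L[ℝ] ℝ) : ξ (h.inverse η) = η (h.inverse ξ) := by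
  rw [← hh.apply_inverse ξ, hh.symm, hh.apply_inverse η, hh.apply_inverse ξ]

theorem halfSq_nonneg (ξ : E →L[ℝ] ℝ) : 0 ≤ halfSq h ξ := by
  have hsq := hh.nonneg (h.inverse ξ)
  rw [hh.apply_inverse] at hsq
  exact mul_nonneg (by norm_num) hsq

theorem halfSq_pos {ξ : E →L[ℝ] ℝ} (hξ : ξ ≠ 0) : 0 < halfSq h ξ := by
  have hsq := hh.pos (h.inverse ξ) fun h0 ↦ hξ (by rw [← hh.apply_inverse ξ, h0, map_zero])
  rw [hh.apply_inverse] at hsq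
  exact mul_pos (by norm_num) hsq

theorem inverse_comp {h' : E →L[ℝ] E →L[ℝ] ℝ} {B C : E →L[ℝ] E} (hh' : IsInner h')
    (hC : ∀ v w, h v w = h' (C v) (C w)) (hCB : C ∘L B = .id ℝ E) (β : E →L[ℝ] ℝ) :
    h.inverse (β ∘L C) = B (h'.inverse β) := by
  have hCB' (v : E) : C (B v) = v := congrArg (fun L : E →L[ℝ] E ↦ L v) hCB
  refine hh.isInvertible.inverse_apply_eq.2 (ContinuousLinearMap.ext fun w ↦ ?_)
  rw [hC, hCB', hh'.apply_inverse, ContinuousLinearMap.comp_apply]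

end IsInner

end LinearAlgebra

section BaseChart

variable {E : Type*} [NormedAddCommGroup E] [NormedSpace ℝ E]
  {M : Type*} [TopologicalSpace M] [ChartedSpace E M] [IsManifold 𝓘(ℝ, E) ∞ M]

theorem flat_isInner (g : Metric E M) (x : M) : IsInner (flat g x) :=
  ⟨g.symm x, g.pos x⟩

theorem chartMetric_apply (g : Metric E M) (x : M) (y v w : E) :
    chartMetric g x y v w = flat g ((extChartAt 𝓘(ℝ, E) x).symm y)
      (coordFrame 𝓘(ℝ, E) x y v) (coordFrame 𝓘(ℝ, E) x y w) := rfl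

theorem chartMetric_self (g : Metric E M) (x : M) :
    chartMetric g x (extChartAt 𝓘(ℝ, E) x x) = flat g x := by
  ext v w
  rw [chartMetric_apply, coordFrame_self, extChartAt_to_inv]
  rfl

theorem chartMetric_isInner (g : Metric E M) {x : M} {y : E}
    (hy : y ∈ (extChartAt 𝓘(ℝ, E) x).target) : IsInner (chartMetric g x y) := by
  have hflat := flat_isInner g ((extChartAt 𝓘(ℝ, E) x).symm y)
  refine ⟨fun v w ↦ hflat.symm _ _, fun v hv ↦ hflat.pos _ fun h0 ↦ hv ?_⟩
  exact (isInvertible_coordFrame (I := 𝓘(ℝ, E)) hy).injective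
    (Eq.trans (b := (0 : E)) h0 (map_zero (coordFrame 𝓘(ℝ, E) x y)).symm)

theorem symmL_trivializationAt_eq_coordFrame {x x' : M}
    (hx : x' ∈ (extChartAt 𝓘(ℝ, E) x).source) :
    (trivializationAt E (TangentSpace 𝓘(ℝ, E)) x).symmL ℝ x' =
      coordFrame 𝓘(ℝ, E) x (extChartAt 𝓘(ℝ, E) x x') := by
  have h := TangentBundle.symmL_trivializationAt (I := 𝓘(ℝ, E)) (x₀ := x) (x := x')
    (by rwa [← extChartAt_source 𝓘(ℝ, E)])
  rwa [modelWithCornersSelf_coe, Set.range_id, mfderivWithin_univ] at h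

theorem chartMetric_contDiffAt (g : Metric E M) {x : M} {y : E}
    (hy : y ∈ (extChartAt 𝓘(ℝ, E) x).target) : ContDiffAt ℝ ∞ (chartMetric g x) y := by
  have hsource {y' : E} (hy' : y' ∈ (extChartAt 𝓘(ℝ, E) x).target) :
      (extChartAt 𝓘(ℝ, E) x).symm y' ∈ (chartAt E x).source := by
    rw [← extChartAt_source 𝓘(ℝ, E)]
    exact (extChartAt 𝓘(ℝ, E) x).map_target hy'
  have hg := g.contMDiff ((extChartAt 𝓘(ℝ, E) x).symm y)
  rw [(trivializationAt (E →L[ℝ] E →L[ℝ] ℝ)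
    (fun x : M ↦ TangentSpace 𝓘(ℝ, E) x →L[ℝ] TangentSpace 𝓘(ℝ, E) x →L[ℝ] ℝ)
      x).contMDiffAt_section_iff (by simpa using hsource hy)] at hg
  have hsymm : ContMDiffAt 𝓘(ℝ, E) 𝓘(ℝ, E) ∞ (extChartAt 𝓘(ℝ, E) x).symm y :=
    (contMDiffOn_extChartAt_symm x).contMDiffAt ((isOpen_extChartAt_target x).mem_nhds hy)
  refine (hg.comp y hsymm).contDiffAt.congr_of_eventuallyEq ?_
  filter_upwards [(isOpen_extChartAt_target x).mem_nhds hy] with y' hy'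
  have hsource' := hsource hy'
  have htriv (u : E) : (trivializationAt E (TangentSpace 𝓘(ℝ, E)) x).symm
      ((extChartAt 𝓘(ℝ, E) x).symm y') u = coordFrame 𝓘(ℝ, E) x y' u := by
    have h := symmL_trivializationAt_eq_coordFrame ((extChartAt 𝓘(ℝ, E) x).map_target hy')
    rw [(extChartAt 𝓘(ℝ, E) x).right_inv hy'] at h
    rw [← Trivialization.symmL_apply (R := ℝ) _ (by simpa using hsource')]
    exact congrArg (fun L : E →L[ℝ] E ↦ L u) h
  ext v w
  rw [Function.comp_apply, hom_trivializationAt_apply,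
    inCoordinates_apply_eq₂ (by simpa using hsource') (by simpa using hsource') (by simp),
    chartMetric_apply, ← htriv v, ← htriv w]
  simp only [Trivial.fiberBundle_trivializationAt', Trivial.linearMapAt_trivialization]
  rfl

theorem chartMetric_transition (g : Metric E M) {x x₀ : M} {y : E}
    (hy : y ∈ coordOverlap 𝓘(ℝ, E) x x₀) (v w : E) :
    chartMetric g x y v w = chartMetric g x₀ (coordTransition 𝓘(ℝ, E) x x₀ y)
      (fderiv ℝ (coordTransition 𝓘(ℝ, E) x x₀) y v)
      (fderiv ℝ (coordTransition 𝓘(ℝ, E) x x₀) y w) := by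
  rw [chartMetric_apply, chartMetric_apply, extChartAt_symm_coordTransition hy,
    coordFrame_eq_comp_fderiv hy]
  rfl

end BaseChart

section LeviCivita

variable {E : Type*} [NormedAddCommGroup E] [NormedSpace ℝ E]

/-- `Γ` is the value at `y` of the Christoffel symbols of the Levi-Civita connection of the metric
`h` on a vector space. -/
structure IsLeviCivitaAt (h : E → E →L[ℝ] E →L[ℝ] ℝ) (Γ : E →L[ℝ] E →L[ℝ] E) (y : E) : Prop where
  symm : ∀ u v, Γ u v = Γ v u
  metric : ∀ u v w, fderiv ℝ h y u v w = h y (Γ u v) w + h y v (Γ u w)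

omit [NormedAddCommGroup E] [NormedSpace ℝ E] in
theorem eq_zero_of_symm_of_antisymm {T : E → E → E → ℝ} (hsymm : ∀ u v w, T u v w = T v u w)
    (hanti : ∀ u v w, T u v w = -T u w v) (u v w : E) : T u v w = 0 := by
  linarith [hsymm u v w, hanti v u w, hsymm v w u, hanti w v u, hsymm w u v, hanti u w v]

theorem fderiv_apply_apply {G : Type*} [NormedAddCommGroup G] [NormedSpace ℝ G]
    {h : E → E →L[ℝ] E →L[ℝ] G} {y : E} (hh : DifferentiableAt ℝ h y)
    (u v w : E) : fderiv ℝ (fun x ↦ h x v w) y u = fderiv ℝ h y u v w := by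
  simpa using
    fderiv_bilinear_apply hh (differentiableAt_const v) (differentiableAt_const w) u

section Transition

variable {h h' : E → E →L[ℝ] E →L[ℝ] ℝ} {φ : E → E} {y : E}

theorem fderiv_pullbackMetric (hφ : ContDiffAt ℝ 2 φ y) (hh : DifferentiableAt ℝ h y)
    (hh' : DifferentiableAt ℝ h' (φ y))
    (hpull : ∀ᶠ x in 𝓝 y, ∀ v w, h x v w = h' (φ x) (fderiv ℝ φ x v) (fderiv ℝ φ x w))
    (u v w : E) :
    fderiv ℝ h y u v w =
      fderiv ℝ h' (φ y) (fderiv ℝ φ y u) (fderiv ℝ φ y v) (fderiv ℝ φ y w)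
      + h' (φ y) (fderiv ℝ (fderiv ℝ φ) y u v) (fderiv ℝ φ y w)
      + h' (φ y) (fderiv ℝ φ y v) (fderiv ℝ (fderiv ℝ φ) y u w) := by
  have hφ1 : DifferentiableAt ℝ φ y := hφ.differentiableAt (by norm_num)
  have hφ2 : DifferentiableAt ℝ (fderiv ℝ φ) y :=
    (hφ.fderiv_right (m := 1) (by norm_num)).differentiableAt (by norm_num)
  have hvw : (fun x ↦ h x v w) =ᶠ[𝓝 y]
      fun x ↦ h' (φ x) (fderiv ℝ φ x v) (fderiv ℝ φ x w) := hpull.mono fun x hx ↦ hx v w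
  have hconst (a : E) : DifferentiableAt ℝ (fun x ↦ fderiv ℝ φ x a) y :=
    hφ2.clm_apply (differentiableAt_const a)
  have hD2 (a : E) : fderiv ℝ (fun x ↦ fderiv ℝ φ x a) y u = fderiv ℝ (fderiv ℝ φ) y u a := by
    rw [fderiv_clm_apply hφ2 (differentiableAt_const a)]
    simp
  have hh'φ : DifferentiableAt ℝ (fun x ↦ h' (φ x)) y := hh'.comp y hφ1
  rw [← fderiv_apply_apply hh, hvw.fderiv_eq,
    fderiv_bilinear_apply hh'φ (hconst v) (hconst w), hD2, hD2,
    fderiv_fun_comp (f := φ) (g := h') y hh' hφ1]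
  rfl

/-- The difference of the two sides is a tensor which is symmetric in `u`, `v` and, since both
connections are metric, antisymmetric in its last two arguments; so it vanishes. -/
theorem IsLeviCivitaAt.transition {Γ Γ' : E →L[ℝ] E →L[ℝ] E} (hΓ : IsLeviCivitaAt h Γ y)
    (hΓ' : IsLeviCivitaAt h' Γ' (φ y)) (hφ : ContDiffAt ℝ 2 φ y) (hh : DifferentiableAt ℝ h y)
    (hh' : DifferentiableAt ℝ h' (φ y)) (hin : IsInner (h' (φ y)))
    (hsurj : Function.Surjective (fderiv ℝ φ y))
    (hpull : ∀ᶠ x in 𝓝 y, ∀ v w, h x v w = h' (φ x) (fderiv ℝ φ x v) (fderiv ℝ φ x w)) (u v : E) :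
    fderiv ℝ φ y (Γ u v) =
      Γ' (fderiv ℝ φ y u) (fderiv ℝ φ y v) + fderiv ℝ (fderiv ℝ φ) y u v := by
  set S : E → E → E := fun u v ↦ fderiv ℝ φ y (Γ u v) -
    (Γ' (fderiv ℝ φ y u) (fderiv ℝ φ y v) + fderiv ℝ (fderiv ℝ φ) y u v) with hS
  have hSsymm (u v w : E) : h' (φ y) (S u v) (fderiv ℝ φ y w) =
      h' (φ y) (S v u) (fderiv ℝ φ y w) := by
    simp only [hS]
    rw [hΓ.symm u v, hΓ'.symm (fderiv ℝ φ y u), (hφ.isSymmSndFDerivAt (by simp)).eq u v]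
  have hSanti (u v w : E) : h' (φ y) (S u v) (fderiv ℝ φ y w) =
      -h' (φ y) (S u w) (fderiv ℝ φ y v) := by
    have hmetric := fderiv_pullbackMetric hφ hh hh' hpull u v w
    rw [hΓ.metric, hΓ'.metric, hpull.self_of_nhds, hpull.self_of_nhds] at hmetric
    simp only [hS, map_sub, map_add, sub_apply, add_apply]
    rw [hin.symm (fderiv ℝ φ y (Γ u w)), hin.symm (Γ' _ (fderiv ℝ φ y w)),
      hin.symm (fderiv ℝ (fderiv ℝ φ) y u w)]
    linarith
  refine sub_eq_zero.1 (hin.eq_zero_of_forall fun w ↦ ?_)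
  obtain ⟨w', rfl⟩ := hsurj w
  exact eq_zero_of_symm_of_antisymm hSsymm hSanti u v w'

end Transition

end LeviCivita

section Christoffel

variable {E : Type*} [NormedAddCommGroup E] [NormedSpace ℝ E]
  {M : Type*} [TopologicalSpace M] [ChartedSpace E M] [IsManifold 𝓘(ℝ, E) ∞ M]

theorem fderiv_chartMetric_symm (g : Metric E M) {x : M} {y : E}
    (hy : y ∈ (extChartAt 𝓘(ℝ, E) x).target) (u v w : E) :
    fderiv ℝ (chartMetric g x) y u v w = fderiv ℝ (chartMetric g x) y u w v := by
  have hd := (chartMetric_contDiffAt g hy).differentiableAt (by simp)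
  have hsymm : (fun z ↦ chartMetric g x z v w) = fun z ↦ chartMetric g x z w v :=
    funext fun _ ↦ (flat_isInner g _).symm _ _
  rw [← fderiv_apply_apply hd, hsymm, fderiv_apply_apply hd]

variable [FiniteDimensional ℝ E]

theorem chartMetric_christoffel (g : Metric E M) {x : M} {y : E}
    (hy : y ∈ (extChartAt 𝓘(ℝ, E) x).target) (u v w : E) :
    chartMetric g x y (christoffel g x y u v) w =
      (fderiv ℝ (chartMetric g x) y u v w + fderiv ℝ (chartMetric g x) y v u w
        - fderiv ℝ (chartMetric g x) y w u v) / 2 := by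
  change chartMetric g x y ((chartMetric g x y).inverse (christoffelFirst g x y u v)) w = _
  rw [(chartMetric_isInner g hy).apply_inverse]
  simp only [christoffelFirst, flipCLM, FunLike.coe_smul, Pi.smul_apply, sub_apply, add_apply,
    ContinuousLinearMap.flip_apply, ContinuousLinearMap.comp_apply, smul_eq_mul,
    ContinuousLinearEquiv.coe_coe, LinearIsometryEquiv.coe_toContinuousLinearEquiv, coe_flipₗᵢ]
  ring

theorem christoffel_isLeviCivitaAt (g : Metric E M) {x : M} {y : E}
    (hy : y ∈ (extChartAt 𝓘(ℝ, E) x).target) :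
    IsLeviCivitaAt (chartMetric g x) (christoffel g x y) y where
  symm u v := by
    refine sub_eq_zero.1 ((chartMetric_isInner g hy).eq_zero_of_forall fun w ↦ ?_)
    rw [map_sub, sub_apply, chartMetric_christoffel g hy, chartMetric_christoffel g hy,
      fderiv_chartMetric_symm g hy w u v]
    ring
  metric u v w := by
    rw [(chartMetric_isInner g hy).symm v, chartMetric_christoffel g hy,
      chartMetric_christoffel g hy, fderiv_chartMetric_symm g hy u w v]
    ring

theorem christoffel_transition (g : Metric E M) {x x₀ : M} {y : E}
    (hy : y ∈ coordOverlap 𝓘(ℝ, E) x x₀) (u v : E) :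
    fderiv ℝ (coordTransition 𝓘(ℝ, E) x x₀) y (christoffel g x y u v) =
      christoffel g x₀ (coordTransition 𝓘(ℝ, E) x x₀ y)
        (fderiv ℝ (coordTransition 𝓘(ℝ, E) x x₀) y u)
        (fderiv ℝ (coordTransition 𝓘(ℝ, E) x x₀) y v)
      + fderiv ℝ (fderiv ℝ (coordTransition 𝓘(ℝ, E) x x₀)) y u v := by
  have hy₀ := (coordTransition_mem_coordOverlap hy).1
  have hinj : Function.Injective (fderiv ℝ (coordTransition 𝓘(ℝ, E) x x₀) y) := by
    have h := (isInvertible_coordFrame hy.1).injective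
    rw [coordFrame_eq_comp_fderiv hy] at h
    exact Function.Injective.of_comp h
  refine IsLeviCivitaAt.transition (christoffel_isLeviCivitaAt g hy.1)
    (christoffel_isLeviCivitaAt g hy₀) ((contDiffAt_coordTransition hy).of_le (by norm_cast))
    ((chartMetric_contDiffAt g hy.1).differentiableAt (by simp))
    ((chartMetric_contDiffAt g hy₀).differentiableAt (by simp)) (chartMetric_isInner g hy₀)
    (LinearMap.injective_iff_surjective (f := (fderiv ℝ _ y).toLinearMap).1 hinj) ?_ u v
  filter_upwards [(isOpen_coordOverlap x x₀).mem_nhds hy] with z hz v w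
  exact chartMetric_transition g hz v w

end Christoffel

section LocalModel

variable {E : Type*} [NormedAddCommGroup E] [NormedSpace ℝ E]

/-- The form `u ↦ ξ(Γ(u, ·))` of a connection `Γ`, whose graph is the horizontal space at the
covector `ξ`. -/
def connForm (Γ : E →L[ℝ] E →L[ℝ] E) (ξ : E →L[ℝ] ℝ) : E →L[ℝ] E →L[ℝ] ℝ :=
  (compL ℝ E E ℝ ξ) ∘L Γ

theorem connForm_apply (Γ : E →L[ℝ] E →L[ℝ] E) (ξ : E →L[ℝ] ℝ) (u v : E) :
    connForm Γ ξ u v = ξ (Γ u v) := rfl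

/-- The endomorphism `u^H ↦ (A u)^V`, `β^V ↦ (S β)^H` for the horizontal lift `u^H = (u, K u)` and
the vertical lift `β^V = (0, β)`. -/
def liftTensor (K A : E →L[ℝ] E →L[ℝ] ℝ) (S : (E →L[ℝ] ℝ) →L[ℝ] E) :
    E × (E →L[ℝ] ℝ) →L[ℝ] E × (E →L[ℝ] ℝ) :=
  inr ℝ E (E →L[ℝ] ℝ) ∘L A ∘L fst ℝ E (E →L[ℝ] ℝ)
    + ((ContinuousLinearMap.id ℝ E).prod K) ∘L S ∘L
      (snd ℝ E (E →L[ℝ] ℝ) - K ∘L fst ℝ E (E →L[ℝ] ℝ))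

theorem liftTensor_apply (K A : E →L[ℝ] E →L[ℝ] ℝ) (S : (E →L[ℝ] ℝ) →L[ℝ] E)
    (v : E × (E →L[ℝ] ℝ)) :
    liftTensor K A S v = (S (v.2 - K v.1), A v.1 + K (S (v.2 - K v.1))) := by
  simp [liftTensor]

/-- The form `u ↦ a u♭ + b ξ(u) ξ`. -/
def naturalFlat (h : E →L[ℝ] E →L[ℝ] ℝ) (ξ : E →L[ℝ] ℝ) (a b : ℝ) : E →L[ℝ] E →L[ℝ] ℝ :=
  a • h + b • ξ.smulRight ξ

/-- The map `β ↦ a β♯ + b g⁻¹(ξ, β) ξ♯`. -/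
def naturalSharp (h : E →L[ℝ] E →L[ℝ] ℝ) (ξ : E →L[ℝ] ℝ) (a b : ℝ) : (E →L[ℝ] ℝ) →L[ℝ] E :=
  a • h.inverse + b • (ξ ∘L h.inverse).smulRight (h.inverse ξ)

theorem naturalFlat_apply (h : E →L[ℝ] E →L[ℝ] ℝ) (ξ : E →L[ℝ] ℝ) (a b : ℝ) (u v : E) :
    naturalFlat h ξ a b u v = a * h u v + b * (ξ u * ξ v) := by
  simp [naturalFlat]

theorem naturalSharp_apply (h : E →L[ℝ] E →L[ℝ] ℝ) (ξ : E →L[ℝ] ℝ) (a b : ℝ) (β : E →L[ℝ] ℝ) :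
    naturalSharp h ξ a b β = a • h.inverse β + (b * ξ (h.inverse β)) • h.inverse ξ := by
  simp [naturalSharp, smul_smul]

/-- The energy density of the metric `h` on a vector space, at the point `z.1` and the covector
`z.2`. -/
def localEnergy (h : E → E →L[ℝ] E →L[ℝ] ℝ) (z : E × (E →L[ℝ] ℝ)) : ℝ := halfSq (h z.1) z.2

/-- The field of forms `u ↦ a(t) u♭ + b(t) ξ(u) ξ` on `E × E*`, where `ξ` is the covector and `t`
the energy density of `h`. -/
def localFlat (h : E → E →L[ℝ] E →L[ℝ] ℝ) (a b : ℝ → ℝ) (z : E × (E →L[ℝ] ℝ)) :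
    E →L[ℝ] E →L[ℝ] ℝ :=
  naturalFlat (h z.1) z.2 (a (localEnergy h z)) (b (localEnergy h z))

/-- The natural diagonal tensor field of the metric `h` with connection `Γ` on a vector space. -/
def localTensor (h : E → E →L[ℝ] E →L[ℝ] ℝ) (Γ : E → E →L[ℝ] E →L[ℝ] E) (a₁ b₁ a₂ b₂ : ℝ → ℝ)
    (z : E × (E →L[ℝ] ℝ)) : E × (E →L[ℝ] ℝ) →L[ℝ] E × (E →L[ℝ] ℝ) :=
  liftTensor (connForm (Γ z.1) z.2) (localFlat h a₁ b₁ z)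
    (naturalSharp (h z.1) z.2 (a₂ (localEnergy h z)) (b₂ (localEnergy h z)))

end LocalModel

section CotangentChart

variable {E : Type*} [NormedAddCommGroup E] [NormedSpace ℝ E]
  {M : Type*} [TopologicalSpace M] [ChartedSpace E M] [IsManifold 𝓘(ℝ, E) ∞ M]

theorem energy_eq_halfSq (g : Metric E M) (p : CotangentBundle E M) :
    energy g p = halfSq (flat g p.proj) (covector p) := rfl

theorem cotangent_extChartAt_apply {p q : CotangentBundle E M}
    (hq : q.proj ∈ (extChartAt 𝓘(ℝ, E) p.proj).source) :
    extChartAt (cotangentModel E) p q =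
      (extChartAt 𝓘(ℝ, E) p.proj q.proj,
        covector q ∘L coordFrame 𝓘(ℝ, E) p.proj (extChartAt 𝓘(ℝ, E) p.proj q.proj)) := by
  rw [FiberBundle.extChartAt]
  refine Prod.ext rfl ?_
  simp only [extChartAt, OpenPartialHomeomorph.extend, modelWithCornersSelf_partialEquiv,
    PartialEquiv.trans_refl, PartialEquiv.coe_trans, PartialEquiv.prod_coe,
    PartialHomeomorph.toFun_eq_coe, OpenPartialHomeomorph.coe_toPartialHomeomorph,
    PartialEquiv.refl_coe, id_eq, Trivialization.coe_coe, Function.comp_apply,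
    hom_trivializationAt_apply, inCoordinates, Trivial.fiberBundle_trivializationAt',
    Trivial.continuousLinearMapAt_trivialization, id_comp]
  exact congrArg (fun L : E →L[ℝ] E ↦ covector q ∘L L) (symmL_trivializationAt_eq_coordFrame hq)

theorem cotangent_mem_target_iff {p : CotangentBundle E M} {z : E × (E →L[ℝ] ℝ)} :
    z ∈ (extChartAt (cotangentModel E) p).target ↔
      z.1 ∈ (extChartAt 𝓘(ℝ, E) p.proj).target := by
  rw [FiberBundle.extChartAt_target]
  refine ⟨fun h ↦ h.1.1, fun h ↦ ⟨⟨h, ?_⟩, trivial⟩⟩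
  simpa using (extChartAt 𝓘(ℝ, E) p.proj).map_target h

theorem cotangent_mem_source_iff {p q : CotangentBundle E M} :
    q ∈ (extChartAt (cotangentModel E) p).source ↔
      q.proj ∈ (extChartAt 𝓘(ℝ, E) p.proj).source := by
  rw [FiberBundle.extChartAt]
  refine ⟨fun h ↦ h.2.1, fun h ↦ ⟨?_, h, trivial⟩⟩
  simpa using h

section

variable {p : CotangentBundle E M} {z : E × (E →L[ℝ] ℝ)}
  (hz : z.1 ∈ (extChartAt 𝓘(ℝ, E) p.proj).target)
include hz

theorem cotangent_extChartAt_symm_proj :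
    ((extChartAt (cotangentModel E) p).symm z).proj = (extChartAt 𝓘(ℝ, E) p.proj).symm z.1 := by
  have hz' := cotangent_mem_target_iff.2 hz
  have hsource := cotangent_mem_source_iff.1 ((extChartAt (cotangentModel E) p).map_target hz')
  have h := (extChartAt (cotangentModel E) p).right_inv hz'
  rw [cotangent_extChartAt_apply hsource] at h
  rw [← congrArg Prod.fst h, (extChartAt 𝓘(ℝ, E) p.proj).left_inv hsource]

theorem covector_comp_coordFrame :
    covector ((extChartAt (cotangentModel E) p).symm z) ∘L coordFrame 𝓘(ℝ, E) p.proj z.1 =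
      z.2 := by
  have hz' := cotangent_mem_target_iff.2 hz
  have h := (extChartAt (cotangentModel E) p).right_inv hz'
  rw [cotangent_extChartAt_apply (cotangent_mem_source_iff.1
    ((extChartAt (cotangentModel E) p).map_target hz')), cotangent_extChartAt_symm_proj hz,
    (extChartAt 𝓘(ℝ, E) p.proj).right_inv hz] at h
  exact congrArg Prod.snd h

theorem covector_extChartAt_symm :
    covector ((extChartAt (cotangentModel E) p).symm z) =
      z.2 ∘L (coordFrame 𝓘(ℝ, E) p.proj z.1).inverse := by
  ext v
  rw [ContinuousLinearMap.comp_apply, ← covector_comp_coordFrame hz,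
    ContinuousLinearMap.comp_apply, (isInvertible_coordFrame hz).self_apply_inverse]

theorem flat_extChartAt_symm (g : Metric E M) (v w : E) :
    flat g ((extChartAt (cotangentModel E) p).symm z).proj v w =
      chartMetric g p.proj z.1 ((coordFrame 𝓘(ℝ, E) p.proj z.1).inverse v)
        ((coordFrame 𝓘(ℝ, E) p.proj z.1).inverse w) := by
  rw [chartMetric_apply, (isInvertible_coordFrame hz).self_apply_inverse,
    (isInvertible_coordFrame hz).self_apply_inverse, cotangent_extChartAt_symm_proj hz]

end

theorem coordTransition_cotangent {p q : CotangentBundle E M} {z : E × (E →L[ℝ] ℝ)}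
    (hz : z.1 ∈ coordOverlap 𝓘(ℝ, E) p.proj q.proj) :
    coordTransition (cotangentModel E) p q z =
      (coordTransition 𝓘(ℝ, E) p.proj q.proj z.1,
        z.2 ∘L fderiv ℝ (coordTransition 𝓘(ℝ, E) q.proj p.proj)
          (coordTransition 𝓘(ℝ, E) p.proj q.proj z.1)) := by
  have hproj := cotangent_extChartAt_symm_proj hz.1
  have hframe := coordFrame_eq_comp_fderiv (coordTransition_mem_coordOverlap hz)
  rw [coordTransition_coordTransition hz] at hframe
  rw [coordTransition, Function.comp_apply, cotangent_extChartAt_apply (by rw [hproj]; exact hz.2),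
    hproj]
  change (coordTransition 𝓘(ℝ, E) p.proj q.proj z.1,
    _ ∘L coordFrame 𝓘(ℝ, E) q.proj (coordTransition 𝓘(ℝ, E) p.proj q.proj z.1)) = _
  rw [hframe, ← ContinuousLinearMap.comp_assoc, covector_comp_coordFrame hz.1]

omit [TopologicalSpace M] [ChartedSpace E M] [IsManifold 𝓘(ℝ, E) ∞ M] in
theorem fderiv_cotangentMap {ψ : E → E} {A : E → E →L[ℝ] E} {z : E × (E →L[ℝ] ℝ)}
    (hψ : DifferentiableAt ℝ ψ z.1) (hA : DifferentiableAt ℝ A (ψ z.1)) (v : E × (E →L[ℝ] ℝ)) :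
    fderiv ℝ (fun z' : E × (E →L[ℝ] ℝ) ↦ (ψ z'.1, z'.2 ∘L A (ψ z'.1))) z v =
      (fderiv ℝ ψ z.1 v.1,
        v.2 ∘L A (ψ z.1) + z.2 ∘L fderiv ℝ A (ψ z.1) (fderiv ℝ ψ z.1 v.1)) := by
  have hfst : HasFDerivAt (fun z' : E × (E →L[ℝ] ℝ) ↦ ψ z'.1) _ z :=
    hψ.hasFDerivAt.comp z hasFDerivAt_fst
  have hsnd : HasFDerivAt (fun z' : E × (E →L[ℝ] ℝ) ↦ A (ψ z'.1)) _ z :=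
    hA.hasFDerivAt.comp z hfst
  rw [(hfst.prodMk (hasFDerivAt_snd.clm_comp hsnd)).fderiv]
  exact Prod.ext rfl (add_comm _ _)

variable {p : CotangentBundle E M} {z : E × (E →L[ℝ] ℝ)}
  (hz : z.1 ∈ (extChartAt 𝓘(ℝ, E) p.proj).target)
include hz

theorem coordFrame_cotangent {q : CotangentBundle E M}
    (hq : (extChartAt (cotangentModel E) p).symm z = q) (v : E × (E →L[ℝ] ℝ)) :
    coordFrame (cotangentModel E) p z v =
      (coordFrame 𝓘(ℝ, E) p.proj z.1 v.1,
        v.2 ∘L (coordFrame 𝓘(ℝ, E) p.proj z.1).inverse +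
        z.2 ∘L fderiv ℝ (fderiv ℝ (coordTransition 𝓘(ℝ, E) q.proj p.proj))
          (extChartAt 𝓘(ℝ, E) q.proj q.proj) (coordFrame 𝓘(ℝ, E) p.proj z.1 v.1)) := by
  have hproj : (extChartAt 𝓘(ℝ, E) p.proj).symm z.1 = q.proj := by
    rw [← hq, cotangent_extChartAt_symm_proj hz]
  have hoverlap : z.1 ∈ coordOverlap 𝓘(ℝ, E) p.proj q.proj :=
    ⟨hz, by rw [Set.mem_preimage, hproj]; exact mem_extChartAt_source _⟩
  have hψz : coordTransition 𝓘(ℝ, E) p.proj q.proj z.1 = extChartAt 𝓘(ℝ, E) q.proj q.proj := by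
    rw [coordTransition, Function.comp_apply, hproj]
  have hψ := (contDiffAt_coordTransition hoverlap).differentiableAt (by simp)
  have hA : DifferentiableAt ℝ (fderiv ℝ (coordTransition 𝓘(ℝ, E) q.proj p.proj))
      (coordTransition 𝓘(ℝ, E) p.proj q.proj z.1) :=
    ((contDiffAt_coordTransition (coordTransition_mem_coordOverlap hoverlap)).fderiv_right
      (m := 1) (by norm_cast)).differentiableAt (by simp)
  have hcot := (continuous_fst.tendsto z).eventually
    ((isOpen_coordOverlap p.proj q.proj).mem_nhds hoverlap)
  rw [coordFrame_eq_fderiv (cotangent_mem_target_iff.2 hz) hq,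
    EventuallyEq.fderiv_eq (hcot.mono fun _ h ↦ coordTransition_cotangent h),
    fderiv_cotangentMap hψ hA, hψz, inverse_coordFrame hz hproj, coordFrame_eq_fderiv hz hproj]

/-- A coordinate frame of `T*M` respects horizontal and vertical lifts. -/
theorem coordFrame_cotangent_eq_lift [FiniteDimensional ℝ E] (g : Metric E M)
    {q : CotangentBundle E M} (hq : (extChartAt (cotangentModel E) p).symm z = q)
    (v : E × (E →L[ℝ] ℝ)) :
    coordFrame (cotangentModel E) p z v =
      (coordFrame 𝓘(ℝ, E) p.proj z.1 v.1,
        (v.2 - connForm (christoffel g p.proj z.1) z.2 v.1) ∘L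
            (coordFrame 𝓘(ℝ, E) p.proj z.1).inverse
          + connForm (christoffelAt g q.proj) (covector q)
            (coordFrame 𝓘(ℝ, E) p.proj z.1 v.1)) := by
  have hproj : (extChartAt 𝓘(ℝ, E) p.proj).symm z.1 = q.proj := by
    rw [← hq, cotangent_extChartAt_symm_proj hz]
  have hqs : q.proj ∈ (extChartAt 𝓘(ℝ, E) p.proj).source := by
    rw [← hproj]
    exact (extChartAt 𝓘(ℝ, E) p.proj).map_target hz
  rw [coordFrame_cotangent hz hq, ← hq, covector_extChartAt_symm hz, hq]
  refine Prod.ext rfl (ContinuousLinearMap.ext fun w ↦ ?_)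
  have hΓ := christoffel_transition g (extChartAt_self_mem_coordOverlap hqs)
    (coordFrame 𝓘(ℝ, E) p.proj z.1 v.1) w
  rw [← inverse_coordFrame hz hproj, (isInvertible_coordFrame hz).inverse_apply_self,
    coordTransition_self, ← hproj, (extChartAt 𝓘(ℝ, E) p.proj).right_inv hz, hproj] at hΓ
  simp only [add_apply, ContinuousLinearMap.comp_apply, sub_apply, connForm_apply, christoffelAt,
    hΓ, map_add]
  ring

end CotangentChart

section Transfer

variable {E : Type*} [NormedAddCommGroup E] [NormedSpace ℝ E]

theorem liftTensor_transport {B C : E →L[ℝ] E} {K K' A A' : E →L[ℝ] E →L[ℝ] ℝ}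
    {S S' : (E →L[ℝ] ℝ) →L[ℝ] E} (hA : ∀ u, A u ∘L C = A' (B u))
    (hS : ∀ κ, S' (κ ∘L C) = B (S κ)) (v : E × (E →L[ℝ] ℝ)) :
    (B (liftTensor K A S v).1, ((liftTensor K A S v).2 - K (liftTensor K A S v).1) ∘L C
      + K' (B (liftTensor K A S v).1)) =
      liftTensor K' A' S' (B v.1, (v.2 - K v.1) ∘L C + K' (B v.1)) := by
  simp only [liftTensor_apply, add_sub_cancel_right, hA, hS]

variable [FiniteDimensional ℝ E]
  {M : Type*} [TopologicalSpace M] [ChartedSpace E M] [IsManifold 𝓘(ℝ, E) ∞ M]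
  {p : CotangentBundle E M} {z : E × (E →L[ℝ] ℝ)}

theorem inverse_flat_extChartAt_symm (g : Metric E M)
    (hz : z.1 ∈ (extChartAt 𝓘(ℝ, E) p.proj).target) (β : E →L[ℝ] ℝ) :
    (flat g ((extChartAt (cotangentModel E) p).symm z).proj).inverse
        (β ∘L (coordFrame 𝓘(ℝ, E) p.proj z.1).inverse) =
      coordFrame 𝓘(ℝ, E) p.proj z.1 ((chartMetric g p.proj z.1).inverse β) := by
  have hframe := isInvertible_coordFrame hz
  exact (flat_isInner g _).inverse_comp (chartMetric_isInner g hz) (flat_extChartAt_symm hz g)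
    (ContinuousLinearMap.ext hframe.inverse_apply_self) β

theorem energy_extChartAt_symm (g : Metric E M)
    (hz : z.1 ∈ (extChartAt 𝓘(ℝ, E) p.proj).target) :
    energy g ((extChartAt (cotangentModel E) p).symm z) =
      localEnergy (chartMetric g p.proj) z := by
  rw [energy_eq_halfSq, localEnergy, halfSq, halfSq, covector_extChartAt_symm hz,
    inverse_flat_extChartAt_symm g hz, ContinuousLinearMap.comp_apply,
    (isInvertible_coordFrame hz).inverse_apply_self]

theorem isCoordTensor_naturalTensor (g : Metric E M) (a₁ b₁ a₂ b₂ : ℝ → ℝ)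
    (p : CotangentBundle E M) :
    IsCoordTensor (cotangentModel E) p (naturalTensor g a₁ b₁ a₂ b₂)
      (localTensor (chartMetric g p.proj) (christoffel g p.proj) a₁ b₁ a₂ b₂) := by
  filter_upwards [extChartAt_target_mem_nhds (I := cotangentModel E) p] with z hzt v
  have hz := cotangent_mem_target_iff.1 hzt
  have hframe := isInvertible_coordFrame hz
  rw [coordFrame_cotangent_eq_lift hz g rfl]
  change _ = liftTensor (connForm _ _) (naturalFlat _ _ _ _) (naturalSharp _ _ _ _)
    (coordFrame (cotangentModel E) p z v)
  rw [coordFrame_cotangent_eq_lift hz g rfl, energy_extChartAt_symm g hz,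
    covector_extChartAt_symm hz]
  refine liftTensor_transport (fun u ↦ ContinuousLinearMap.ext fun w ↦ ?_) (fun κ ↦ ?_) v
  · simp only [localFlat, ContinuousLinearMap.comp_apply, naturalFlat_apply,
      hframe.inverse_apply_self, flat_extChartAt_symm hz]
  · rw [naturalSharp_apply, naturalSharp_apply, inverse_flat_extChartAt_symm g hz,
      inverse_flat_extChartAt_symm g hz, map_add, map_smul, map_smul,
      ContinuousLinearMap.comp_apply, hframe.inverse_apply_self]

end Transfer

section LocalForm

variable {E : Type*} [NormedAddCommGroup E] [NormedSpace ℝ E]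
  {F : Type*} [NormedAddCommGroup F] [NormedSpace ℝ F]

/-- The form `g⁻¹(ξ, κ)`, where `κ` is the vertical part of a tangent vector; it is the differential
of the energy density when `Γ` is the Levi-Civita connection. -/
def vertForm (h : E →L[ℝ] E →L[ℝ] ℝ) (Γ : E →L[ℝ] E →L[ℝ] E) (ξ : E →L[ℝ] ℝ) :
    E × (E →L[ℝ] ℝ) →L[ℝ] ℝ :=
  ContinuousLinearMap.apply ℝ ℝ (h.inverse ξ) ∘L
    (snd ℝ E (E →L[ℝ] ℝ) - connForm Γ ξ ∘L fst ℝ E (E →L[ℝ] ℝ))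

theorem vertForm_apply (h : E →L[ℝ] E →L[ℝ] ℝ) (Γ : E →L[ℝ] E →L[ℝ] E) (ξ : E →L[ℝ] ℝ)
    (v : E × (E →L[ℝ] ℝ)) :
    vertForm h Γ ξ v = (v.2 - connForm Γ ξ v.1) (h.inverse ξ) := rfl

/-- The Liouville form `p dq`. -/
def liouvilleForm (ξ : E →L[ℝ] ℝ) : E × (E →L[ℝ] ℝ) →L[ℝ] ℝ := ξ ∘L fst ℝ E (E →L[ℝ] ℝ)

theorem liouvilleForm_apply (ξ : E →L[ℝ] ℝ) (v : E × (E →L[ℝ] ℝ)) :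
    liouvilleForm ξ v = ξ v.1 := rfl

variable (E) in
/-- The canonical symplectic form `dq ∧ dp`. -/
def canonicalForm : E × (E →L[ℝ] ℝ) →L[ℝ] E × (E →L[ℝ] ℝ) →L[ℝ] ℝ :=
  ((ContinuousLinearMap.id ℝ (E →L[ℝ] ℝ)).bilinearComp
    (snd ℝ E (E →L[ℝ] ℝ)) (fst ℝ E (E →L[ℝ] ℝ))).flip -
  (ContinuousLinearMap.id ℝ (E →L[ℝ] ℝ)).bilinearComp
    (snd ℝ E (E →L[ℝ] ℝ)) (fst ℝ E (E →L[ℝ] ℝ))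

theorem canonicalForm_apply (v w : E × (E →L[ℝ] ℝ)) :
    canonicalForm E v w = w.2 v.1 - v.2 w.1 := rfl

/-- The exterior product of two linear forms. -/
def wedge (θ τ : F →L[ℝ] ℝ) : F →L[ℝ] F →L[ℝ] ℝ := θ.smulRight τ - τ.smulRight θ

theorem wedge_apply (θ τ : F →L[ℝ] ℝ) (v w : F) :
    wedge θ τ v w = θ v * τ w - τ v * θ w := by
  simp [wedge]

/-- The form `λ(t) ω + μ(t) p dq ∧ dt` of the metric `h` with connection `Γ` on a vector space, for
the canonical symplectic form `ω`. -/
def localForm (h : E → E →L[ℝ] E →L[ℝ] ℝ) (Γ : E → E →L[ℝ] E →L[ℝ] E) (lam mu : ℝ → ℝ)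
    (z : E × (E →L[ℝ] ℝ)) : E × (E →L[ℝ] ℝ) →L[ℝ] E × (E →L[ℝ] ℝ) →L[ℝ] ℝ :=
  lam (localEnergy h z) • canonicalForm E + mu (localEnergy h z) •
    wedge (liouvilleForm z.2) (vertForm (h z.1) (Γ z.1) z.2)

theorem localForm_apply (h : E → E →L[ℝ] E →L[ℝ] ℝ) (Γ : E → E →L[ℝ] E →L[ℝ] E) (lam mu : ℝ → ℝ)
    (z v w : E × (E →L[ℝ] ℝ)) :
    localForm h Γ lam mu z v w = lam (localEnergy h z) * (w.2 v.1 - v.2 w.1) +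
      mu (localEnergy h z) * (z.2 v.1 * vertForm (h z.1) (Γ z.1) z.2 w
        - vertForm (h z.1) (Γ z.1) z.2 v * z.2 w.1) := by
  simp [localForm, canonicalForm_apply, wedge_apply, liouvilleForm_apply]

end LocalForm

section NaturalEndomorphisms

variable {E : Type*} [NormedAddCommGroup E] [NormedSpace ℝ E]
  {h : E →L[ℝ] E →L[ℝ] ℝ} {ξ : E →L[ℝ] ℝ}

theorem apply_inverse_self (h : E →L[ℝ] E →L[ℝ] ℝ) (ξ : E →L[ℝ] ℝ) :
    ξ (h.inverse ξ) = 2 * halfSq h ξ := by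
  rw [halfSq]
  ring

theorem naturalFlat_of_smul_eq {w : E} {s : ℝ} (hw : ξ w • ξ = s • h w) (a b : ℝ) :
    naturalFlat h ξ a b w = (a + s * b) • h w := by
  ext v
  have hv := congrArg (fun η : E →L[ℝ] ℝ ↦ η v) hw
  simp only [smul_apply, smul_eq_mul] at hv
  rw [naturalFlat_apply, hv, smul_apply, smul_eq_mul]
  ring

variable [FiniteDimensional ℝ E]

theorem exists_ne_zero_apply_eq_zero (hn : 2 ≤ Module.finrank ℝ E) (ξ : E →L[ℝ] ℝ) :
    ∃ u : E, u ≠ 0 ∧ ξ u = 0 := by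
  have hker : LinearMap.ker ξ.toLinearMap ≠ ⊥ :=
    LinearMap.ker_ne_bot_of_finrank_lt (by rw [Module.finrank_self]; omega)
  obtain ⟨u, hu, hu0⟩ := (Submodule.ne_bot_iff _).1 hker
  exact ⟨u, hu0, hu⟩

namespace IsInner

variable (hh : IsInner h)
include hh

theorem exists_halfSq_eq [Nontrivial E] {t : ℝ} (ht : 0 ≤ t) :
    ∃ ξ : E →L[ℝ] ℝ, halfSq h ξ = t := by
  obtain ⟨v, hv⟩ := exists_ne (0 : E)
  have hpos := hh.pos v hv
  refine ⟨Real.sqrt (2 * t / h v v) • h v, ?_⟩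
  rw [halfSq, map_smul, hh.inverse_apply]
  simp only [smul_apply, map_smul, smul_eq_mul]
  rw [← mul_assoc √_, Real.mul_self_sqrt (by positivity)]
  field_simp

theorem exists_radial [Nontrivial E] (ξ : E →L[ℝ] ℝ) :
    ∃ w : E, w ≠ 0 ∧ ξ w • ξ = (2 * halfSq h ξ) • h w := by
  rcases eq_or_ne ξ 0 with rfl | hξ
  · obtain ⟨w, hw⟩ := exists_ne (0 : E)
    exact ⟨w, hw, by simp [halfSq]⟩
  · refine ⟨h.inverse ξ, fun h0 ↦ hξ ?_, by rw [hh.apply_inverse, apply_inverse_self]⟩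
    rw [← hh.apply_inverse ξ, h0, map_zero]

theorem naturalSharp_of_smul_eq {w : E} {s : ℝ} (hw : ξ w • ξ = s • h w) (a b : ℝ) :
    naturalSharp h ξ a b (h w) = (a + s * b) • w := by
  have hinv := congrArg h.inverse hw
  rw [map_smul, map_smul, hh.inverse_apply] at hinv
  rw [naturalSharp_apply, hh.inverse_apply, mul_smul, hinv, smul_smul, ← add_smul, mul_comm b]

theorem naturalFlat_naturalSharp (a b c d : ℝ) (u : E) (β : E →L[ℝ] ℝ) :
    naturalFlat h ξ c d u (naturalSharp h ξ a b β) =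
      c * a * β u + (c * b + d * (a + 2 * halfSq h ξ * b)) * (ξ u * β (h.inverse ξ)) := by
  have hflat (η : E →L[ℝ] ℝ) : h u (h.inverse η) = η u := by rw [hh.symm, hh.apply_inverse]
  simp only [naturalFlat_apply, naturalSharp_apply, map_add, map_smul, smul_eq_mul, hflat,
    apply_inverse_self, hh.apply_inverse_symm ξ β]
  ring

end IsInner

end NaturalEndomorphisms

section Coefficients

variable {E : Type*} [NormedAddCommGroup E] [NormedSpace ℝ E]
  {M : Type*} [TopologicalSpace M] [ChartedSpace E M] [IsManifold 𝓘(ℝ, E) ∞ M]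

/-- The algebraic relations, at energy density `t`, between the coefficients of an almost
para-Hermitian structure; they are its restrictions to covectors orthogonal and parallel to the base
point. -/
structure ParaHermitianRelations (a₁ b₁ a₂ b₂ c₁ d₁ c₂ d₂ : ℝ → ℝ) (t : ℝ) : Prop where
  mul_orth : a₁ t * a₂ t = 1
  mul_radial : (a₁ t + 2 * t * b₁ t) * (a₂ t + 2 * t * b₂ t) = 1
  metric_orth : c₂ t * a₁ t ^ 2 = -c₁ t
  metric_radial : (c₂ t + 2 * t * d₂ t) * (a₁ t + 2 * t * b₁ t) ^ 2 = -(c₁ t + 2 * t * d₁ t)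

theorem naturalTensor_apply (g : Metric E M) (a₁ b₁ a₂ b₂ : ℝ → ℝ) (p : CotangentBundle E M)
    (w : E × (E →L[ℝ] ℝ)) :
    (naturalTensor g a₁ b₁ a₂ b₂ p w : E × (E →L[ℝ] ℝ)) =
      liftTensor (connForm (christoffelAt g p.proj) (covector p))
        (naturalFlat (flat g p.proj) (covector p) (a₁ (energy g p)) (b₁ (energy g p)))
        (naturalSharp (flat g p.proj) (covector p) (a₂ (energy g p)) (b₂ (energy g p))) w := rfl

theorem naturalTensor_hlift (g : Metric E M) (a₁ b₁ a₂ b₂ : ℝ → ℝ) (p : CotangentBundle E M)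
    (w : E) :
    (naturalTensor g a₁ b₁ a₂ b₂ p (hlift g p w) : E × (E →L[ℝ] ℝ)) =
      (0, naturalFlat (flat g p.proj) (covector p) (a₁ (energy g p)) (b₁ (energy g p)) w) := by
  refine (naturalTensor_apply g a₁ b₁ a₂ b₂ p _).trans ?_
  change liftTensor _ _ _ (w, connForm (christoffelAt g p.proj) (covector p) w) = _
  simp only [liftTensor_apply, sub_self, map_zero, add_zero]

theorem naturalTensor_vlift_fst (g : Metric E M) (a₁ b₁ a₂ b₂ : ℝ → ℝ) (p : CotangentBundle E M)
    (β : E →L[ℝ] ℝ) :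
    (naturalTensor g a₁ b₁ a₂ b₂ p ((0 : E), β) : E × (E →L[ℝ] ℝ)).1 =
      naturalSharp (flat g p.proj) (covector p) (a₂ (energy g p)) (b₂ (energy g p)) β := by
  refine (congrArg Prod.fst (naturalTensor_apply g a₁ b₁ a₂ b₂ p _)).trans ?_
  simp only [liftTensor_apply, sub_zero, map_zero]

theorem naturalSharp_naturalFlat {g : Metric E M} {a₁ b₁ a₂ b₂ : ℝ → ℝ}
    (hP : IsAlmostProduct (cotangentModel E) (naturalTensor g a₁ b₁ a₂ b₂))
    (p : CotangentBundle E M) (w : E) :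
    naturalSharp (flat g p.proj) (covector p) (a₂ (energy g p)) (b₂ (energy g p))
      (naturalFlat (flat g p.proj) (covector p) (a₁ (energy g p)) (b₁ (energy g p)) w) = w := by
  rw [← naturalTensor_vlift_fst g a₁ b₁]
  exact congrArg Prod.fst ((congrArg (fun v : E × (E →L[ℝ] ℝ) ↦
    (naturalTensor g a₁ b₁ a₂ b₂ p v : E × (E →L[ℝ] ℝ)))
      (naturalTensor_hlift g a₁ b₁ a₂ b₂ p w)).symm.trans (hP p (hlift g p w)))

variable [FiniteDimensional ℝ E]

theorem naturalMetric_apply (g : Metric E M) (c₁ d₁ c₂ d₂ : ℝ → ℝ) (p : CotangentBundle E M)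
    (v w : E × (E →L[ℝ] ℝ)) :
    naturalMetric g c₁ d₁ c₂ d₂ p v w =
      naturalFlat (flat g p.proj) (covector p) (c₁ (energy g p)) (d₁ (energy g p)) v.1 w.1
      + vpart g p w (naturalSharp (flat g p.proj) (covector p) (c₂ (energy g p)) (d₂ (energy g p))
        (vpart g p v)) := by
  rw [naturalSharp_apply, naturalFlat_apply, map_add, map_smul, map_smul,
    (flat_isInner g p.proj).apply_inverse_symm (vpart g p w) (vpart g p v),
    (flat_isInner g p.proj).apply_inverse_symm (vpart g p w) (covector p), smul_eq_mul, smul_eq_mul,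
    mul_assoc]
  rfl

theorem naturalMetric_naturalFlat {g : Metric E M} {a₁ b₁ a₂ b₂ c₁ d₁ c₂ d₂ : ℝ → ℝ}
    (hGP : IsAlmostParaHermitian (cotangentModel E) (naturalMetric g c₁ d₁ c₂ d₂)
      (naturalTensor g a₁ b₁ a₂ b₂)) (p : CotangentBundle E M) (w : E) {α : E →L[ℝ] ℝ}
    (hα : naturalFlat (flat g p.proj) (covector p) (a₁ (energy g p)) (b₁ (energy g p)) w = α) :
    α (naturalSharp (flat g p.proj) (covector p) (c₂ (energy g p)) (d₂ (energy g p)) α) =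
      -naturalFlat (flat g p.proj) (covector p) (c₁ (energy g p)) (d₁ (energy g p)) w w := by
  have hP := naturalTensor_hlift g a₁ b₁ a₂ b₂ p w
  rw [hα] at hP
  have hG : naturalMetric g c₁ d₁ c₂ d₂ p ((0 : E), α) ((0 : E), α) =
      -naturalMetric g c₁ d₁ c₂ d₂ p (hlift g p w) (hlift g p w) :=
    (congrArg (fun v : E × (E →L[ℝ] ℝ) ↦ naturalMetric g c₁ d₁ c₂ d₂ p v v) hP).symm.trans
      (hGP.compatible p (hlift g p w) (hlift g p w))
  have hvert : vpart g p ((0 : E), α) = α := by simp [vpart]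
  have hhor : vpart g p (hlift g p w) = 0 := by simp [vpart, hlift]
  rw [naturalMetric_apply, naturalMetric_apply, hvert, hhor, zero_apply, add_zero]
    at hG
  simp only [map_zero, zero_add] at hG
  exact hG

/-- The relations on the eigenspace of eigenvalue `s` of `w ↦ p(w) p♯`. -/
theorem relations_of_smul_eq {g : Metric E M} {a₁ b₁ a₂ b₂ c₁ d₁ c₂ d₂ : ℝ → ℝ}
    (hGP : IsAlmostParaHermitian (cotangentModel E) (naturalMetric g c₁ d₁ c₂ d₂)
      (naturalTensor g a₁ b₁ a₂ b₂)) (p : CotangentBundle E M) {w : E} (hw0 : w ≠ 0) {s : ℝ}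
    (hw : covector p w • covector p = s • flat g p.proj w) :
    (a₁ (energy g p) + s * b₁ (energy g p)) * (a₂ (energy g p) + s * b₂ (energy g p)) = 1 ∧
    (c₂ (energy g p) + s * d₂ (energy g p)) * (a₁ (energy g p) + s * b₁ (energy g p)) ^ 2 =
      -(c₁ (energy g p) + s * d₁ (energy g p)) := by
  have hh := flat_isInner g p.proj
  constructor
  · have hJJ := naturalSharp_naturalFlat hGP.almostProduct p w
    rw [naturalFlat_of_smul_eq hw, map_smul, hh.naturalSharp_of_smul_eq hw, smul_smul] at hJJ
    exact smul_left_injective ℝ hw0 (hJJ.trans (one_smul ℝ w).symm)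
  · have hG := naturalMetric_naturalFlat hGP p w (naturalFlat_of_smul_eq hw _ _)
    rw [naturalFlat_of_smul_eq hw, map_smul, hh.naturalSharp_of_smul_eq hw] at hG
    simp only [smul_apply, map_smul, smul_eq_mul] at hG
    refine mul_right_cancel₀ (hh.pos w hw0).ne' ?_
    linear_combination hG

theorem paraHermitianRelations (hn : 2 ≤ Module.finrank ℝ E) [Nonempty M] (g : Metric E M)
    {a₁ b₁ a₂ b₂ c₁ d₁ c₂ d₂ : ℝ → ℝ}
    (hGP : IsAlmostParaHermitian (cotangentModel E) (naturalMetric g c₁ d₁ c₂ d₂)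
      (naturalTensor g a₁ b₁ a₂ b₂)) {t : ℝ} (ht : 0 ≤ t) :
    ParaHermitianRelations a₁ b₁ a₂ b₂ c₁ d₁ c₂ d₂ t := by
  have : Nontrivial E := Module.nontrivial_of_finrank_pos (R := ℝ) (by omega)
  obtain ⟨x⟩ := ‹Nonempty M›
  have hh := flat_isInner g x
  obtain ⟨ξ, rfl⟩ := hh.exists_halfSq_eq ht
  obtain ⟨u, hu0, hu⟩ := exists_ne_zero_apply_eq_zero hn ξ
  obtain ⟨w, hw0, hw⟩ := hh.exists_radial ξ
  let p : CotangentBundle E M := ⟨x, ξ⟩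
  obtain ⟨mul_orth, metric_orth⟩ := relations_of_smul_eq hGP p hu0 (s := 0)
    (show ξ u • ξ = (0 : ℝ) • flat g x u by rw [hu, zero_smul, zero_smul])
  obtain ⟨mul_radial, metric_radial⟩ := relations_of_smul_eq hGP p hw0 hw
  simp only [zero_mul, add_zero] at mul_orth metric_orth
  exact ⟨mul_orth, mul_radial, metric_orth, metric_radial⟩

end Coefficients

section ProportionalityFactors

variable {a₁ b₁ a₂ b₂ c₁ d₁ c₂ d₂ lam mu : ℝ → ℝ} {t : ℝ}

theorem ParaHermitianRelations.ne_zero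
    (hrel : ParaHermitianRelations a₁ b₁ a₂ b₂ c₁ d₁ c₂ d₂ t) :
    a₁ t ≠ 0 ∧ a₂ t ≠ 0 ∧ a₁ t + 2 * t * b₁ t ≠ 0 ∧ a₂ t + 2 * t * b₂ t ≠ 0 :=
  ⟨left_ne_zero_of_mul_eq_one hrel.mul_orth, right_ne_zero_of_mul_eq_one hrel.mul_orth,
    left_ne_zero_of_mul_eq_one hrel.mul_radial, right_ne_zero_of_mul_eq_one hrel.mul_radial⟩

theorem neg_div_eq_div_of_mul_eq_one {r s c d : ℝ} (hrs : r * s = 1) (hcd : d * r ^ 2 = -c) :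
    -(d / s) = c / r := by
  have hr := left_ne_zero_of_mul_eq_one hrs
  have hs := right_ne_zero_of_mul_eq_one hrs
  rw [← neg_div, div_eq_div_iff hs hr]
  linear_combination d * r * hrs - s * hcd

theorem exists_proportionalityFactors
    (ha₁ : SmoothCoeff a₁) (hb₁ : SmoothCoeff b₁) (hc₁ : SmoothCoeff c₁) (hd₁ : SmoothCoeff d₁)
    (hrel : ∀ t, 0 ≤ t → ParaHermitianRelations a₁ b₁ a₂ b₂ c₁ d₁ c₂ d₂ t) :
    ∃ lam mu : ℝ → ℝ, AreProportionalityFactors a₁ b₁ a₂ b₂ c₁ d₁ c₂ d₂ lam mu := by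
  have hne (t : ℝ) (ht : 0 ≤ t) := (hrel t ht).ne_zero
  have hradial : ContDiffOn ℝ ∞ (fun t ↦ a₁ t + 2 * t * b₁ t) (Set.Ici 0) :=
    ha₁.add ((contDiffOn_const.mul contDiffOn_id).mul hb₁)
  refine ⟨fun t ↦ c₁ t / a₁ t,
    fun t ↦ (d₁ t * a₁ t - c₁ t * b₁ t) / (a₁ t * (a₁ t + 2 * t * b₁ t)), ?_, ?_, hne, ?_, ?_⟩
  · exact hc₁.div ha₁ fun t ht ↦ (hne t ht).1
  · exact ((hd₁.mul ha₁).sub (hc₁.mul hb₁)).div (ha₁.mul hradial) fun t ht ↦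
      mul_ne_zero (hne t ht).1 (hne t ht).2.2.1
  · exact fun t ht ↦
      ⟨rfl, neg_div_eq_div_of_mul_eq_one (hrel t ht).mul_orth (hrel t ht).metric_orth⟩
  · intro t ht
    obtain ⟨ha, -, har, -⟩ := hne t ht
    have hdiv : (c₁ t + 2 * t * d₁ t) / (a₁ t + 2 * t * b₁ t) = c₁ t / a₁ t +
        2 * t * ((d₁ t * a₁ t - c₁ t * b₁ t) / (a₁ t * (a₁ t + 2 * t * b₁ t))) := by
      field_simp
      ring
    exact ⟨hdiv, (neg_div_eq_div_of_mul_eq_one (hrel t ht).mul_radial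
      (hrel t ht).metric_radial).trans hdiv⟩

theorem AreProportionalityFactors.mul_orth
    (hf : AreProportionalityFactors a₁ b₁ a₂ b₂ c₁ d₁ c₂ d₂ lam mu)
    (hrel : ParaHermitianRelations a₁ b₁ a₂ b₂ c₁ d₁ c₂ d₂ t) (ht : 0 ≤ t) :
    c₁ t * a₂ t = lam t ∧ a₁ t * c₂ t = -lam t := by
  obtain ⟨ha₁, ha₂, -⟩ := hf.ne_zero t ht
  obtain ⟨hc₁, hc₂⟩ := hf.first t ht
  rw [div_eq_iff ha₁] at hc₁
  rw [← neg_div, div_eq_iff ha₂] at hc₂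
  constructor
  · linear_combination a₂ t * hc₁ + lam t * hrel.mul_orth
  · linear_combination -a₁ t * hc₂ - lam t * hrel.mul_orth

theorem AreProportionalityFactors.mul_radial
    (hf : AreProportionalityFactors a₁ b₁ a₂ b₂ c₁ d₁ c₂ d₂ lam mu)
    (hrel : ParaHermitianRelations a₁ b₁ a₂ b₂ c₁ d₁ c₂ d₂ t) (ht : 0 < t) :
    c₁ t * b₂ t + d₁ t * (a₂ t + 2 * t * b₂ t) = mu t ∧
      a₁ t * d₂ t + b₁ t * (c₂ t + 2 * t * d₂ t) = -mu t := by
  obtain ⟨-, -, hr₁, hr₂⟩ := hf.ne_zero t ht.le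
  obtain ⟨hlam₁, hlam₂⟩ := hf.mul_orth hrel ht.le
  obtain ⟨hc₁, hc₂⟩ := hf.second t ht.le
  rw [div_eq_iff hr₁] at hc₁
  rw [← neg_div, div_eq_iff hr₂] at hc₂
  have h2t : 2 * t ≠ 0 := by positivity
  constructor <;> refine mul_left_cancel₀ h2t ?_
  · linear_combination (a₂ t + 2 * t * b₂ t) * hc₁
      + (lam t + 2 * t * mu t) * hrel.mul_radial - hlam₁
  · linear_combination -(a₁ t + 2 * t * b₁ t) * hc₂
      - (lam t + 2 * t * mu t) * hrel.mul_radial - hlam₂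

end ProportionalityFactors

section AssociatedForm

variable {E : Type*} [NormedAddCommGroup E] [NormedSpace ℝ E] [FiniteDimensional ℝ E]
  {M : Type*} [TopologicalSpace M] [ChartedSpace E M] [IsManifold 𝓘(ℝ, E) ∞ M]
  {a₁ b₁ a₂ b₂ c₁ d₁ c₂ d₂ lam mu : ℝ → ℝ}

theorem associatedForm_eq_vpart (g : Metric E M)
    (hrel : ∀ t, 0 ≤ t → ParaHermitianRelations a₁ b₁ a₂ b₂ c₁ d₁ c₂ d₂ t)
    (hf : AreProportionalityFactors a₁ b₁ a₂ b₂ c₁ d₁ c₂ d₂ lam mu)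
    (p : CotangentBundle E M) (v w : E × (E →L[ℝ] ℝ)) :
    associatedForm (cotangentModel E) (naturalMetric g c₁ d₁ c₂ d₂) (naturalTensor g a₁ b₁ a₂ b₂)
      p v w = lam (energy g p) * (vpart g p w v.1 - vpart g p v w.1) + mu (energy g p) *
      (covector p v.1 * vpart g p w ((flat g p.proj).inverse (covector p))
        - vpart g p v ((flat g p.proj).inverse (covector p)) * covector p w.1) := by
  have hh := flat_isInner g p.proj
  have ht : 0 ≤ energy g p := hh.halfSq_nonneg _
  refine (naturalMetric_apply g c₁ d₁ c₂ d₂ p v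
    (naturalTensor g a₁ b₁ a₂ b₂ p w : E × (E →L[ℝ] ℝ))).trans ?_
  have hhor : (naturalTensor g a₁ b₁ a₂ b₂ p w : E × (E →L[ℝ] ℝ)).1 =
      naturalSharp (flat g p.proj) (covector p) (a₂ (energy g p)) (b₂ (energy g p))
        (vpart g p w) :=
    congrArg Prod.fst ((naturalTensor_apply g a₁ b₁ a₂ b₂ p w).trans (liftTensor_apply _ _ _ w))
  have hvert : vpart g p (naturalTensor g a₁ b₁ a₂ b₂ p w : E × (E →L[ℝ] ℝ)) =
      naturalFlat (flat g p.proj) (covector p) (a₁ (energy g p)) (b₁ (energy g p)) w.1 := by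
    refine (congrArg (vpart g p) (naturalTensor_apply g a₁ b₁ a₂ b₂ p w)).trans ?_
    change (liftTensor _ _ _ w).2 - connForm _ _ (liftTensor _ _ _ w).1 = _
    rw [liftTensor_apply, add_sub_cancel_right]
  rw [hhor, hvert, hh.naturalFlat_naturalSharp, hh.naturalFlat_naturalSharp, ← energy_eq_halfSq,
    (hf.mul_orth (hrel _ ht) ht).1, (hf.mul_orth (hrel _ ht) ht).2]
  rcases eq_or_ne (covector p) 0 with hξ | hξ
  · simp only [hξ, zero_apply, map_zero]
    ring
  · have htpos : 0 < energy g p := hh.halfSq_pos hξ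
    rw [(hf.mul_radial (hrel _ ht) htpos).1, (hf.mul_radial (hrel _ ht) htpos).2]
    ring

theorem isCoordForm_associatedForm (g : Metric E M)
    (hrel : ∀ t, 0 ≤ t → ParaHermitianRelations a₁ b₁ a₂ b₂ c₁ d₁ c₂ d₂ t)
    (hf : AreProportionalityFactors a₁ b₁ a₂ b₂ c₁ d₁ c₂ d₂ lam mu) (p : CotangentBundle E M) :
    IsCoordForm (cotangentModel E) p (associatedForm (cotangentModel E)
      (naturalMetric g c₁ d₁ c₂ d₂) (naturalTensor g a₁ b₁ a₂ b₂))
      (localForm (chartMetric g p.proj) (christoffel g p.proj) lam mu) := by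
  filter_upwards [extChartAt_target_mem_nhds (I := cotangentModel E) p] with z hzt v w
  have hz := cotangent_mem_target_iff.1 hzt
  have hframe := isInvertible_coordFrame hz
  have hΓ := (christoffel_isLeviCivitaAt g hz).symm
  have hv (v : E × (E →L[ℝ] ℝ)) : vpart g ((extChartAt (cotangentModel E) p).symm z)
      (coordFrame (cotangentModel E) p z v : E × (E →L[ℝ] ℝ)) =
      (v.2 - connForm (christoffel g p.proj z.1) z.2 v.1) ∘L
        (coordFrame 𝓘(ℝ, E) p.proj z.1).inverse := by
    rw [coordFrame_cotangent_eq_lift hz g rfl]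
    exact add_sub_cancel_right _ _
  have hh (v : E × (E →L[ℝ] ℝ)) : (coordFrame (cotangentModel E) p z v).1 =
      coordFrame 𝓘(ℝ, E) p.proj z.1 v.1 := by
    rw [coordFrame_cotangent_eq_lift hz g rfl]
  rw [localForm_apply]
  refine (associatedForm_eq_vpart g hrel hf _ (coordFrame (cotangentModel E) p z v)
    (coordFrame (cotangentModel E) p z w)).trans ?_
  rw [hv, hv, hh, hh, energy_extChartAt_symm g hz, covector_extChartAt_symm hz,
    inverse_flat_extChartAt_symm g hz]
  simp only [ContinuousLinearMap.comp_apply, hframe.inverse_apply_self, vertForm_apply, sub_apply,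
    connForm_apply, hΓ w.1]
  ring

end AssociatedForm

section Wedge

variable {F : Type*} [NormedAddCommGroup F] [NormedSpace ℝ F]
  {θ τ : F → F →L[ℝ] ℝ} {θ' τ' : F →L[ℝ] F →L[ℝ] ℝ} {z : F}

theorem hasFDerivAt_wedge (hθ : HasFDerivAt θ θ' z) (hτ : HasFDerivAt τ τ' z) :
    ∃ L : F →L[ℝ] F →L[ℝ] F →L[ℝ] ℝ, HasFDerivAt (fun z ↦ wedge (θ z) (τ z)) L z ∧
      ∀ u v w, L u v w = θ' u v * τ z w + θ z v * τ' u w - (τ' u v * θ z w + τ z v * θ' u w) := by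
  have hθτ : HasFDerivAt (fun z ↦ smulRightL ℝ F (F →L[ℝ] ℝ) (θ z) (τ z)) _ z :=
    (HasFDerivAt.comp z (smulRightL ℝ F (F →L[ℝ] ℝ)).hasFDerivAt hθ).clm_apply hτ
  have hτθ : HasFDerivAt (fun z ↦ smulRightL ℝ F (F →L[ℝ] ℝ) (τ z) (θ z)) _ z :=
    (HasFDerivAt.comp z (smulRightL ℝ F (F →L[ℝ] ℝ)).hasFDerivAt hτ).clm_apply hθ
  refine ⟨_, hθτ.sub hτθ, fun u v w ↦ ?_⟩
  simp only [Function.comp_apply, sub_apply, add_apply, comp_apply, smulRightL_apply_apply,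
    flip_apply, smulRight_apply, smul_apply, smul_eq_mul]
  ring

/-- This is `d(λ(t) σ + μ(t) θ ∧ dt) = (λ'(t) - μ(t)) dt ∧ σ` for `τ = dt`, `dθ = -σ` and
constant `σ`. -/
theorem coordExtDeriv_smul_add_smul_wedge {L M : F → ℝ} {σ : F →L[ℝ] F →L[ℝ] ℝ} {l m : ℝ}
    (hL : HasFDerivAt L (l • τ z) z) (hM : HasFDerivAt M (m • τ z) z)
    (hθ : HasFDerivAt θ θ' z) (hτ : HasFDerivAt τ τ' z) (hτs : ∀ u v, τ' u v = τ' v u)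
    (hσ : ∀ u v, θ' u v - θ' v u = -σ u v) :
    DifferentiableAt ℝ (fun z ↦ L z • σ + M z • wedge (θ z) (τ z)) z ∧ ∀ u v w,
      coordExtDeriv (fun z ↦ L z • σ + M z • wedge (θ z) (τ z)) z u v w =
        (l - M z) * (τ z u * σ v w - τ z v * σ u w + τ z w * σ u v) := by
  obtain ⟨W, hW, hWa⟩ := hasFDerivAt_wedge hθ hτ
  have hD : HasFDerivAt (fun z ↦ L z • σ + M z • wedge (θ z) (τ z)) _ z :=
    (hL.smul_const σ).add (hM.smul hW)
  refine ⟨hD.differentiableAt, fun u v w ↦ ?_⟩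
  rw [coordExtDeriv, hD.fderiv]
  simp only [add_apply, FunLike.coe_smul, Pi.smul_apply, ContinuousLinearMap.smulRight_apply,
    hWa, wedge_apply, smul_eq_mul]
  have hσ' (u v : F) : σ u v = θ' v u - θ' u v := by linear_combination hσ u v
  rw [hτs v u, hτs w u, hτs w v, hσ' u v, hσ' u w, hσ' v w]
  ring

end Wedge

section LocalCalculus

variable {E : Type*} [NormedAddCommGroup E] [NormedSpace ℝ E]

/-- A metric `h` with its Christoffel symbols `Γ` near a point `y` of a vector space, with the
regularity needed to define the curvature at `y`. -/
structure IsLocalMetric (h : E → E →L[ℝ] E →L[ℝ] ℝ) (Γ : E → E →L[ℝ] E →L[ℝ] E) (y : E) :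
    Prop where
  inner : ∀ᶠ x in 𝓝 y, IsInner (h x)
  leviCivita : ∀ᶠ x in 𝓝 y, IsLeviCivitaAt h (Γ x) x
  contDiffAt : ContDiffAt ℝ 2 h y
  differentiableAt : DifferentiableAt ℝ Γ y

theorem differentiableAt_connForm {Γ : E → E →L[ℝ] E →L[ℝ] E} {z : E × (E →L[ℝ] ℝ)}
    (hΓ : DifferentiableAt ℝ Γ z.1) :
    DifferentiableAt ℝ (fun z : E × (E →L[ℝ] ℝ) ↦ connForm (Γ z.1) z.2) z := by
  have hΓfst : DifferentiableAt ℝ (fun z : E × (E →L[ℝ] ℝ) ↦ Γ z.1) z :=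
    hΓ.comp z differentiableAt_fst
  exact ((compL ℝ E E ℝ).differentiableAt.comp z differentiableAt_snd).clm_comp hΓfst

theorem localForm_antisymm (h : E → E →L[ℝ] E →L[ℝ] ℝ) (Γ : E → E →L[ℝ] E →L[ℝ] E)
    (lam mu : ℝ → ℝ) (z v w : E × (E →L[ℝ] ℝ)) :
    localForm h Γ lam mu z v w = -localForm h Γ lam mu z w v := by
  rw [localForm_apply, localForm_apply]
  ring

variable [FiniteDimensional ℝ E] {h : E → E →L[ℝ] E →L[ℝ] ℝ} {Γ : E → E →L[ℝ] E →L[ℝ] E}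
  {z : E × (E →L[ℝ] ℝ)}

theorem contDiffAt_inverse {n : ℕ∞ω} {y : E} (hin : IsInner (h y)) (hh : ContDiffAt ℝ n h y) :
    ContDiffAt ℝ n (fun x ↦ (h x).inverse) y := by
  have : CompleteSpace E := FiniteDimensional.complete ℝ E
  exact hin.isInvertible.contDiffAt_map_inverse.comp y hh

theorem contDiffAt_sharp {n : ℕ∞ω} (hin : IsInner (h z.1)) (hh : ContDiffAt ℝ n h z.1) :
    ContDiffAt ℝ n (fun z : E × (E →L[ℝ] ℝ) ↦ (h z.1).inverse z.2) z :=
  ((contDiffAt_inverse hin hh).comp z contDiffAt_fst).clm_apply contDiffAt_snd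

theorem contDiffAt_localEnergy {n : ℕ∞ω} (hin : IsInner (h z.1)) (hh : ContDiffAt ℝ n h z.1) :
    ContDiffAt ℝ n (localEnergy h) z :=
  contDiffAt_const.mul (contDiffAt_snd.clm_apply (contDiffAt_sharp hin hh))

theorem apply_fderiv_sharp (hin : ∀ᶠ x in 𝓝 z.1, IsInner (h x)) (hh : ContDiffAt ℝ 1 h z.1)
    (v : E × (E →L[ℝ] ℝ)) :
    h z.1 (fderiv ℝ (fun z : E × (E →L[ℝ] ℝ) ↦ (h z.1).inverse z.2) z v) =
      v.2 - fderiv ℝ h z.1 v.1 ((h z.1).inverse z.2) := by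
  have hsharp : HasFDerivAt (fun z : E × (E →L[ℝ] ℝ) ↦ (h z.1).inverse z.2) _ z :=
    ((contDiffAt_sharp hin.self_of_nhds hh).differentiableAt one_ne_zero).hasFDerivAt
  have hfst : HasFDerivAt (fun z : E × (E →L[ℝ] ℝ) ↦ h z.1) _ z :=
    HasFDerivAt.comp z (hh.differentiableAt one_ne_zero).hasFDerivAt hasFDerivAt_fst
  have hinv : (fun z : E × (E →L[ℝ] ℝ) ↦ h z.1 ((h z.1).inverse z.2)) =ᶠ[𝓝 z] fun z ↦ z.2 :=
    ((continuous_fst.tendsto z).eventually hin).mono fun z hz ↦ hz.apply_inverse z.2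
  have hderiv := (hfst.clm_apply hsharp).unique (hasFDerivAt_snd.congr_of_eventuallyEq hinv)
  exact eq_sub_of_add_eq (congrArg (fun L : E × (E →L[ℝ] ℝ) →L[ℝ] E →L[ℝ] ℝ ↦ L v) hderiv)

theorem hasFDerivAt_localEnergy (hin : ∀ᶠ x in 𝓝 z.1, IsInner (h x)) (hh : ContDiffAt ℝ 1 h z.1)
    (hΓ : IsLeviCivitaAt h (Γ z.1) z.1) :
    HasFDerivAt (localEnergy h) (vertForm (h z.1) (Γ z.1) z.2) z := by
  have hz := hin.self_of_nhds
  have hsharp := ((contDiffAt_sharp hz hh).differentiableAt one_ne_zero).hasFDerivAt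
  refine ((hasFDerivAt_snd.clm_apply hsharp).const_mul (1 / 2 : ℝ)).congr_fderiv
    (ContinuousLinearMap.ext fun v ↦ ?_)
  set s := (h z.1).inverse z.2
  set s' := fderiv ℝ (fun z : E × (E →L[ℝ] ℝ) ↦ (h z.1).inverse z.2) z v
  have hflat : h z.1 s = z.2 := hz.apply_inverse z.2
  have hmetric : fderiv ℝ h z.1 v.1 s s = 2 * z.2 (Γ z.1 v.1 s) := by
    rw [hΓ.metric, hz.symm (Γ z.1 v.1 s), hflat]
    ring
  have hs' : z.2 s' = v.2 s - 2 * z.2 (Γ z.1 v.1 s) := by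
    rw [← hmetric, ← hflat, hz.symm, apply_fderiv_sharp hin hh, sub_apply]
  change 1 / 2 * (z.2 s' + v.2 s) = v.2 s - z.2 (Γ z.1 v.1 s)
  linarith

namespace IsLocalMetric

variable (H : IsLocalMetric h Γ z.1)
include H

theorem eventually_hasFDerivAt_localEnergy : ∀ᶠ z' in 𝓝 z,
    HasFDerivAt (localEnergy h) (vertForm (h z'.1) (Γ z'.1) z'.2) z' := by
  have hbase := H.inner.eventually_nhds.and
    (H.leviCivita.and (H.contDiffAt.eventually (by simp)))
  filter_upwards [(continuous_fst.tendsto z).eventually hbase] with z' ⟨hin, hΓ, hh⟩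
  exact ParaKahlerCotangent.hasFDerivAt_localEnergy hin (hh.of_le one_le_two) hΓ

theorem hasFDerivAt_coeff {a : ℝ → ℝ} (ha : SmoothCoeff a) :
    HasFDerivAt (fun z ↦ a (localEnergy h z))
      (coeffDeriv a (localEnergy h z) • vertForm (h z.1) (Γ z.1) z.2) z := by
  have hnonneg : ∀ᶠ z' in 𝓝 z, localEnergy h z' ∈ Set.Ici (0 : ℝ) :=
    ((continuous_fst.tendsto z).eventually H.inner).mono fun z' hz' ↦ hz'.halfSq_nonneg z'.2
  have hderiv : HasDerivWithinAt a (coeffDeriv a (localEnergy h z)) (Set.Ici 0)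
      (localEnergy h z) :=
    (ha.differentiableOn (by simp) _ hnonneg.self_of_nhds).hasDerivWithinAt
  exact hderiv.comp_hasFDerivAt z H.eventually_hasFDerivAt_localEnergy.self_of_nhds hnonneg

theorem vertForm_eventuallyEq :
    (fun z : E × (E →L[ℝ] ℝ) ↦ vertForm (h z.1) (Γ z.1) z.2) =ᶠ[𝓝 z]
      fderiv ℝ (localEnergy h) :=
  H.eventually_hasFDerivAt_localEnergy.mono fun _ hz ↦ hz.fderiv.symm

theorem differentiableAt_vertForm :
    DifferentiableAt ℝ (fun z : E × (E →L[ℝ] ℝ) ↦ vertForm (h z.1) (Γ z.1) z.2) z :=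
  (((contDiffAt_localEnergy H.inner.self_of_nhds H.contDiffAt).fderiv_right (m := 1)
    (by norm_num)).differentiableAt one_ne_zero).congr_of_eventuallyEq H.vertForm_eventuallyEq

theorem fderiv_vertForm_symm (v w : E × (E →L[ℝ] ℝ)) :
    fderiv ℝ (fun z : E × (E →L[ℝ] ℝ) ↦ vertForm (h z.1) (Γ z.1) z.2) z v w =
      fderiv ℝ (fun z : E × (E →L[ℝ] ℝ) ↦ vertForm (h z.1) (Γ z.1) z.2) z w v := by
  rw [H.vertForm_eventuallyEq.fderiv_eq]
  exact ((contDiffAt_localEnergy H.inner.self_of_nhds H.contDiffAt).isSymmSndFDerivAt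
    (by simp)).eq v w

/-- As `dt = vertForm`, this says `d(λ ω + μ θ ∧ dt) = (λ' - μ) dt ∧ ω`, where `θ` is the Liouville
form and `ω` the canonical symplectic form. -/
theorem coordExtDeriv_localForm {lam mu : ℝ → ℝ} (hlam : SmoothCoeff lam)
    (hmu : SmoothCoeff mu) :
    DifferentiableAt ℝ (localForm h Γ lam mu) z ∧ ∀ u v w,
      coordExtDeriv (localForm h Γ lam mu) z u v w =
        (coeffDeriv lam (localEnergy h z) - mu (localEnergy h z)) *
        (vertForm (h z.1) (Γ z.1) z.2 u * canonicalForm E v w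
        - vertForm (h z.1) (Γ z.1) z.2 v * canonicalForm E u w
        + vertForm (h z.1) (Γ z.1) z.2 w * canonicalForm E u v) := by
  have hliouville : HasFDerivAt (fun z : E × (E →L[ℝ] ℝ) ↦ liouvilleForm z.2) _ z :=
    hasFDerivAt_snd.clm_comp (hasFDerivAt_const (fst ℝ E (E →L[ℝ] ℝ)) z)
  refine coordExtDeriv_smul_add_smul_wedge
    (τ := fun z : E × (E →L[ℝ] ℝ) ↦ vertForm (h z.1) (Γ z.1) z.2)
    (H.hasFDerivAt_coeff hlam) (H.hasFDerivAt_coeff hmu) hliouville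
    H.differentiableAt_vertForm.hasFDerivAt H.fderiv_vertForm_symm fun u v ↦ ?_
  simp [canonicalForm_apply]

end IsLocalMetric

end LocalCalculus

section NijenhuisOfInvolution

variable {F : Type*} [NormedAddCommGroup F] [NormedSpace ℝ F]

theorem coordNijenhuis_add_left (J : F → F →L[ℝ] F) (z v v' w : F) :
    coordNijenhuis J z (v + v') w = coordNijenhuis J z v w + coordNijenhuis J z v' w := by
  simp only [coordNijenhuis, map_add, add_apply]
  abel

theorem coordNijenhuis_antisymm (J : F → F →L[ℝ] F) (z v w : F) :
    coordNijenhuis J z v w = -coordNijenhuis J z w v := by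
  simp only [coordNijenhuis]
  abel

theorem fderiv_apply_of_involutive {J : F → F →L[ℝ] F} {z : F} (hJ : DifferentiableAt ℝ J z)
    (hJJ : ∀ᶠ y in 𝓝 z, ∀ v, J y (J y v) = v) (v w : F) :
    fderiv ℝ J z v (J z w) = -J z (fderiv ℝ J z v w) := by
  have hJw := hJ.hasFDerivAt.clm_apply (hasFDerivAt_const w z)
  have hconst : (fun y ↦ J y (J y w)) =ᶠ[𝓝 z] fun _ ↦ w := hJJ.mono fun y hy ↦ hy w
  have hderiv := DFunLike.congr_fun ((hJ.hasFDerivAt.clm_apply hJw).unique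
    ((hasFDerivAt_const w z).congr_of_eventuallyEq hconst)) v
  simp only [add_apply, ContinuousLinearMap.comp_apply, ContinuousLinearMap.flip_apply,
    zero_apply, map_zero, zero_add] at hderiv
  exact eq_neg_of_add_eq_zero_right hderiv

theorem coordNijenhuis_apply_left {J : F → F →L[ℝ] F} {z : F} (hJ : DifferentiableAt ℝ J z)
    (hJJ : ∀ᶠ y in 𝓝 z, ∀ v, J y (J y v) = v) (v w : F) :
    coordNijenhuis J z (J z v) w = -J z (coordNijenhuis J z v w) := by
  simp only [coordNijenhuis, fderiv_apply_of_involutive hJ hJJ, hJJ.self_of_nhds, map_add, map_sub,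
    map_neg]
  abel

theorem coordNijenhuis_eq_zero_iff {J : F → F →L[ℝ] F} {z : F} (hJ : DifferentiableAt ℝ J z)
    (hJJ : ∀ᶠ y in 𝓝 z, ∀ v, J y (J y v) = v) {S : Set F}
    (hS : ∀ v, ∃ a ∈ S, ∃ b ∈ S, v = a + J z b) :
    (∀ v w, coordNijenhuis J z v w = 0) ↔ ∀ v ∈ S, ∀ w ∈ S, coordNijenhuis J z v w = 0 := by
  refine ⟨fun h v _ w _ ↦ h v w, fun h v w ↦ ?_⟩
  have extend_left : ∀ w, (∀ a ∈ S, coordNijenhuis J z a w = 0) →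
      ∀ v, coordNijenhuis J z v w = 0 := by
    intro w hw v
    obtain ⟨a, ha, b, hb, rfl⟩ := hS v
    rw [coordNijenhuis_add_left, coordNijenhuis_apply_left hJ hJJ, hw a ha, hw b hb, map_zero,
      neg_zero, add_zero]
  refine extend_left w (fun a ha ↦ ?_) v
  rw [coordNijenhuis_antisymm, extend_left a fun b hb ↦ h b hb a ha, neg_zero]

end NijenhuisOfInvolution

section HorizontalFields

variable {E F : Type*} [NormedAddCommGroup E] [NormedSpace ℝ E] [NormedAddCommGroup F]
  [NormedSpace ℝ F]

theorem fderiv_prodMk_const_apply {K : E × F → E →L[ℝ] F} {z : E × F}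
    (hK : DifferentiableAt ℝ K z) (e u : E) (x : E × F) :
    fderiv ℝ (fun z ↦ (e, K z u)) z x = (0, fderiv ℝ K z x u) := by
  rw [((hasFDerivAt_const e z).prodMk
    (hK.hasFDerivAt.clm_apply (hasFDerivAt_const u z))).fderiv]
  simp

/-- The field `K` plays the role of a connection: `(u, K u)` is horizontal, `(0, A u)` vertical. -/
theorem coordNijenhuis_horizontal {J : E × F → E × F →L[ℝ] E × F} {K A : E × F → E →L[ℝ] F}
    {z : E × F} (hJ : DifferentiableAt ℝ J z) (hK : DifferentiableAt ℝ K z)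
    (hA : DifferentiableAt ℝ A z) (hJK : ∀ z u, J z (u, K z u) = (0, A z u))
    (hJJ : ∀ v, J z (J z v) = v) {u v : E}
    (hmixed : fderiv ℝ K z (0, A z u) v - fderiv ℝ A z (v, K z v) u
      + (fderiv ℝ A z (u, K z u) v - fderiv ℝ K z (0, A z v) u) = 0) :
    coordNijenhuis J z (u, K z u) (v, K z v) =
      (0, fderiv ℝ A z (0, A z u) v - fderiv ℝ A z (0, A z v) u
        + (fderiv ℝ K z (u, K z u) v - fderiv ℝ K z (v, K z v) u)) := by
  have hfield : ∀ u, DifferentiableAt ℝ (fun z ↦ (u, K z u)) z := fun u ↦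
    (differentiableAt_const u).prodMk (hK.clm_apply (differentiableAt_const u))
  have hbracket := lieBracket_nijenhuis_eq hJ (hfield u) (hfield v)
  simp only [hJK] at hbracket
  rw [← hbracket, hJJ, sub_sub, ← map_add]
  simp only [lieBracket, fderiv_prodMk_const_apply hK, fderiv_prodMk_const_apply hA,
    Prod.mk_sub_mk, Prod.mk_add_mk, sub_self, add_zero, hmixed, Prod.mk_zero_zero, map_zero,
    sub_zero]

variable {K A₁ : F → E →L[ℝ] E →L[ℝ] ℝ} {A₂ : F → (E →L[ℝ] ℝ) →L[ℝ] E} {z : F}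

theorem differentiableAt_liftTensor (hK : DifferentiableAt ℝ K z)
    (hA₁ : DifferentiableAt ℝ A₁ z) (hA₂ : DifferentiableAt ℝ A₂ z) :
    DifferentiableAt ℝ (fun z ↦ liftTensor (K z) (A₁ z) (A₂ z)) z := by
  have hlift : ∀ z, (ContinuousLinearMap.id ℝ E).prod (K z) =
      inl ℝ E (E →L[ℝ] ℝ) + inr ℝ E (E →L[ℝ] ℝ) ∘L K z := fun z ↦ by
    ext u <;> simp
  simp only [liftTensor, hlift]
  have hvert : DifferentiableAt ℝ
      (fun z ↦ inr ℝ E (E →L[ℝ] ℝ) ∘L A₁ z ∘L fst ℝ E (E →L[ℝ] ℝ)) z :=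
    (differentiableAt_const _).clm_comp (hA₁.clm_comp (differentiableAt_const _))
  exact hvert.add ((((differentiableAt_const _).clm_comp hK).const_add _).clm_comp
    (hA₂.clm_comp ((hK.clm_comp (differentiableAt_const _)).const_sub _)))

theorem differentiableAt_naturalFlat {h : F → E →L[ℝ] E →L[ℝ] ℝ} {ξ : F → E →L[ℝ] ℝ}
    {a b : F → ℝ} (hh : DifferentiableAt ℝ h z) (hξ : DifferentiableAt ℝ ξ z)
    (ha : DifferentiableAt ℝ a z) (hb : DifferentiableAt ℝ b z) :
    DifferentiableAt ℝ (fun z ↦ naturalFlat (h z) (ξ z) (a z) (b z)) z := by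
  have hsquare : DifferentiableAt ℝ (fun z ↦ smulRightL ℝ E (E →L[ℝ] ℝ) (ξ z) (ξ z)) z :=
    ((smulRightL ℝ E (E →L[ℝ] ℝ)).differentiableAt.comp z hξ).clm_apply hξ
  exact (ha.smul hh).add (hb.smul hsquare)

theorem differentiableAt_naturalSharp {h : F → E →L[ℝ] E →L[ℝ] ℝ} {ξ : F → E →L[ℝ] ℝ}
    {a b : F → ℝ} (hh : DifferentiableAt ℝ (fun z ↦ (h z).inverse) z)
    (hξ : DifferentiableAt ℝ ξ z) (ha : DifferentiableAt ℝ a z) (hb : DifferentiableAt ℝ b z) :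
    DifferentiableAt ℝ (fun z ↦ naturalSharp (h z) (ξ z) (a z) (b z)) z := by
  have hsquare : DifferentiableAt ℝ
      (fun z ↦ smulRightL ℝ (E →L[ℝ] ℝ) E (ξ z ∘L (h z).inverse) ((h z).inverse (ξ z))) z :=
    ((smulRightL ℝ (E →L[ℝ] ℝ) E).differentiableAt.comp z (hξ.clm_comp hh)).clm_apply
      (hh.clm_apply hξ)
  exact (ha.smul hh).add (hb.smul hsquare)

end HorizontalFields

section LocalNijenhuis

variable {E : Type*} [NormedAddCommGroup E] [NormedSpace ℝ E]

/-- The curvature `R(u, v)w` of a connection in coordinates. -/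
def localCurvature (Γ : E → E →L[ℝ] E →L[ℝ] E) (y u v w : E) : E :=
  fderiv ℝ Γ y u v w - fderiv ℝ Γ y v u w + Γ y u (Γ y v w) - Γ y v (Γ y u w)

/-- The coefficient `a₁ b₁ - a₁' (a₁ + 2t b₁)` of the Nijenhuis tensor of the natural tensor
field. -/
def nijenhuisCoeff (a₁ b₁ : ℝ → ℝ) (t : ℝ) : ℝ :=
  a₁ t * b₁ t - coeffDeriv a₁ t * (a₁ t + 2 * t * b₁ t)

theorem localTensor_horizontal (h : E → E →L[ℝ] E →L[ℝ] ℝ) (Γ : E → E →L[ℝ] E →L[ℝ] E)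
    (a₁ b₁ a₂ b₂ : ℝ → ℝ) (z : E × (E →L[ℝ] ℝ)) (u : E) :
    localTensor h Γ a₁ b₁ a₂ b₂ z (u, connForm (Γ z.1) z.2 u) = (0, localFlat h a₁ b₁ z u) := by
  rw [localTensor, liftTensor_apply, sub_self, map_zero, map_zero, add_zero]

theorem fderiv_connForm_apply {Γ : E → E →L[ℝ] E →L[ℝ] E} {z : E × (E →L[ℝ] ℝ)}
    (hΓ : DifferentiableAt ℝ Γ z.1) (v : E × (E →L[ℝ] ℝ)) (u w : E) :
    fderiv ℝ (fun z : E × (E →L[ℝ] ℝ) ↦ connForm (Γ z.1) z.2) z v u w =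
      v.2 (Γ z.1 u w) + z.2 (fderiv ℝ Γ z.1 v.1 u w) := by
  have hΓfst : HasFDerivAt (fun z : E × (E →L[ℝ] ℝ) ↦ Γ z.1) _ z :=
    HasFDerivAt.comp z hΓ.hasFDerivAt hasFDerivAt_fst
  have hcomp : HasFDerivAt (fun z : E × (E →L[ℝ] ℝ) ↦ connForm (Γ z.1) z.2) _ z :=
    ((compL ℝ E E ℝ).hasFDerivAt.comp z hasFDerivAt_snd).clm_comp hΓfst
  rw [hcomp.fderiv]
  simp [add_comm]

variable [FiniteDimensional ℝ E] {h : E → E →L[ℝ] E →L[ℝ] ℝ} {Γ : E → E →L[ℝ] E →L[ℝ] E}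
  {z : E × (E →L[ℝ] ℝ)} {a₁ b₁ a₂ b₂ : ℝ → ℝ}

namespace IsLocalMetric

variable (H : IsLocalMetric h Γ z.1)
include H

theorem differentiableAt_localFlat (ha₁ : SmoothCoeff a₁) (hb₁ : SmoothCoeff b₁) :
    DifferentiableAt ℝ (localFlat h a₁ b₁) z :=
  differentiableAt_naturalFlat
    ((H.contDiffAt.differentiableAt two_ne_zero).comp z differentiableAt_fst) differentiableAt_snd
    (H.hasFDerivAt_coeff ha₁).differentiableAt (H.hasFDerivAt_coeff hb₁).differentiableAt

theorem differentiableAt_localTensor (ha₁ : SmoothCoeff a₁) (hb₁ : SmoothCoeff b₁)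
    (ha₂ : SmoothCoeff a₂) (hb₂ : SmoothCoeff b₂) :
    DifferentiableAt ℝ (localTensor h Γ a₁ b₁ a₂ b₂) z := by
  have hsharp : DifferentiableAt ℝ (fun z : E × (E →L[ℝ] ℝ) ↦ (h z.1).inverse) z :=
    ((contDiffAt_inverse H.inner.self_of_nhds H.contDiffAt).differentiableAt two_ne_zero).comp z
      differentiableAt_fst
  exact differentiableAt_liftTensor (differentiableAt_connForm H.differentiableAt)
    (H.differentiableAt_localFlat ha₁ hb₁)
    (differentiableAt_naturalSharp hsharp differentiableAt_snd
      (H.hasFDerivAt_coeff ha₂).differentiableAt (H.hasFDerivAt_coeff hb₂).differentiableAt)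

theorem fderiv_localFlat_apply (ha₁ : SmoothCoeff a₁) (hb₁ : SmoothCoeff b₁)
    (v : E × (E →L[ℝ] ℝ)) (u w : E) :
    fderiv ℝ (localFlat h a₁ b₁) z v u w =
      coeffDeriv a₁ (localEnergy h z) * vertForm (h z.1) (Γ z.1) z.2 v * h z.1 u w
        + a₁ (localEnergy h z) * (h z.1 (Γ z.1 v.1 u) w + h z.1 u (Γ z.1 v.1 w))
        + coeffDeriv b₁ (localEnergy h z) * vertForm (h z.1) (Γ z.1) z.2 v * (z.2 u * z.2 w)
        + b₁ (localEnergy h z) * (v.2 u * z.2 w + z.2 u * v.2 w) := by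
  have hfst : HasFDerivAt (fun z : E × (E →L[ℝ] ℝ) ↦ h z.1) _ z :=
    HasFDerivAt.comp z (H.contDiffAt.differentiableAt two_ne_zero).hasFDerivAt hasFDerivAt_fst
  have hsquare : HasFDerivAt
      (fun z : E × (E →L[ℝ] ℝ) ↦ smulRightL ℝ E (E →L[ℝ] ℝ) z.2 z.2) _ z :=
    ((smulRightL ℝ E (E →L[ℝ] ℝ)).hasFDerivAt.comp z hasFDerivAt_snd).clm_apply hasFDerivAt_snd
  have hflat : HasFDerivAt (localFlat h a₁ b₁) _ z :=
    ((H.hasFDerivAt_coeff ha₁).smul hfst).add ((H.hasFDerivAt_coeff hb₁).smul hsquare)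
  rw [hflat.fderiv, ← H.leviCivita.self_of_nhds.metric]
  simp only [Function.comp_apply, add_apply, smul_apply, comp_apply, coe_fst',
    smulRight_apply, smul_eq_mul, coe_snd', smulRightL_apply_apply, flip_apply]
  ring

theorem coordNijenhuis_localTensor_horizontal (ha₁ : SmoothCoeff a₁) (hb₁ : SmoothCoeff b₁)
    (ha₂ : SmoothCoeff a₂) (hb₂ : SmoothCoeff b₂)
    (hJJ : ∀ v, localTensor h Γ a₁ b₁ a₂ b₂ z (localTensor h Γ a₁ b₁ a₂ b₂ z v) = v) (u v : E) :
    (coordNijenhuis (localTensor h Γ a₁ b₁ a₂ b₂) z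
      (u, connForm (Γ z.1) z.2 u) (v, connForm (Γ z.1) z.2 v)).1 = 0 ∧
    ∀ w, (coordNijenhuis (localTensor h Γ a₁ b₁ a₂ b₂) z
      (u, connForm (Γ z.1) z.2 u) (v, connForm (Γ z.1) z.2 v)).2 w =
        z.2 (localCurvature Γ z.1 u v w)
        - nijenhuisCoeff a₁ b₁ (localEnergy h z) * (z.2 u * h z.1 v w - z.2 v * h z.1 u w) := by
  have hinner := H.inner.self_of_nhds
  have hsharp : ∀ u, h z.1 u ((h z.1).inverse z.2) = z.2 u := fun u ↦ by
    rw [hinner.symm, hinner.apply_inverse]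
  have henergy : z.2 ((h z.1).inverse z.2) = 2 * localEnergy h z := apply_inverse_self _ _
  rw [coordNijenhuis_horizontal (K := fun z ↦ connForm (Γ z.1) z.2)
    (H.differentiableAt_localTensor ha₁ hb₁ ha₂ hb₂)
    (differentiableAt_connForm H.differentiableAt) (H.differentiableAt_localFlat ha₁ hb₁)
    (localTensor_horizontal h Γ a₁ b₁ a₂ b₂) hJJ]
  · refine ⟨rfl, fun w ↦ ?_⟩
    simp only [add_apply, sub_apply, fderiv_connForm_apply H.differentiableAt,
      H.fderiv_localFlat_apply ha₁ hb₁, localFlat, naturalFlat_apply, vertForm_apply,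
      connForm_apply, map_zero, zero_apply, henergy, hsharp, localCurvature, nijenhuisCoeff,
      map_add, map_sub, hinner.symm v u]
    ring
  · ext w
    simp only [add_apply, sub_apply, fderiv_connForm_apply H.differentiableAt,
      H.fderiv_localFlat_apply ha₁ hb₁, localFlat, naturalFlat_apply, vertForm_apply,
      connForm_apply, map_zero, zero_apply, H.leviCivita.self_of_nhds.symm v u]
    ring

omit H [FiniteDimensional ℝ E] in
theorem exists_eq_horizontal_add_localTensor_horizontal
    (hJJ : ∀ v, localTensor h Γ a₁ b₁ a₂ b₂ z (localTensor h Γ a₁ b₁ a₂ b₂ z v) = v)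
    (v : E × (E →L[ℝ] ℝ)) :
    ∃ u w : E, v = (u, connForm (Γ z.1) z.2 u)
      + localTensor h Γ a₁ b₁ a₂ b₂ z (w, connForm (Γ z.1) z.2 w) := by
  obtain ⟨u, β⟩ := v
  set κ := β - connForm (Γ z.1) z.2 u
  set w := naturalSharp (h z.1) z.2 (a₂ (localEnergy h z)) (b₂ (localEnergy h z)) κ
  have hvert : localTensor h Γ a₁ b₁ a₂ b₂ z (0, κ) = (w, connForm (Γ z.1) z.2 w) := by
    rw [localTensor, liftTensor_apply, map_zero, map_zero, sub_zero, zero_add]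
  exact ⟨u, w, by rw [← hvert, hJJ, Prod.mk_add_mk, add_zero, add_sub_cancel]⟩

theorem coordNijenhuis_localTensor_eq_zero_iff (ha₁ : SmoothCoeff a₁) (hb₁ : SmoothCoeff b₁)
    (ha₂ : SmoothCoeff a₂) (hb₂ : SmoothCoeff b₂)
    (hJJ : ∀ᶠ z' in 𝓝 z, ∀ v,
      localTensor h Γ a₁ b₁ a₂ b₂ z' (localTensor h Γ a₁ b₁ a₂ b₂ z' v) = v) :
    (∀ v w, coordNijenhuis (localTensor h Γ a₁ b₁ a₂ b₂) z v w = 0) ↔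
      ∀ u v w, z.2 (localCurvature Γ z.1 u v w) =
        nijenhuisCoeff a₁ b₁ (localEnergy h z) * (z.2 u * h z.1 v w - z.2 v * h z.1 u w) := by
  have hz := hJJ.self_of_nhds
  rw [coordNijenhuis_eq_zero_iff (H.differentiableAt_localTensor ha₁ hb₁ ha₂ hb₂) hJJ
    (S := Set.range fun u : E ↦ (u, connForm (Γ z.1) z.2 u))]
  · simp only [Set.forall_mem_range]
    refine forall₂_congr fun u v ↦ ?_
    obtain ⟨hfst, hsnd⟩ := H.coordNijenhuis_localTensor_horizontal ha₁ hb₁ ha₂ hb₂ hz u v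
    simp only [Prod.ext_iff, hfst, ContinuousLinearMap.ext_iff, hsnd, Prod.fst_zero, Prod.snd_zero,
      zero_apply, sub_eq_zero, true_and]
  · intro v
    obtain ⟨u, w, hv⟩ := exists_eq_horizontal_add_localTensor_horizontal hz v
    exact ⟨_, ⟨u, rfl⟩, _, ⟨w, rfl⟩, hv⟩

end IsLocalMetric

end LocalNijenhuis

section CurvatureAlgebra

/-- A quadrilinear form with the symmetries of a Riemann curvature tensor. Additivity in the other
arguments follows from these symmetries. -/
structure IsCurvatureLike {E : Type*} [AddCommGroup E] (B : E → E → E → E → ℝ) : Prop where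
  add_left : ∀ u u' v w x, B (u + u') v w x = B u v w x + B u' v w x
  antisymm : ∀ u v w x, B u v w x = -B v u w x
  skew : ∀ u v w x, B u v w x = -B u v x w
  bianchi : ∀ u v w x, B u v w x + B v w u x + B w u v x = 0

namespace IsCurvatureLike

variable {E : Type*} [AddCommGroup E] {B : E → E → E → E → ℝ} (hB : IsCurvatureLike B)
include hB

theorem pair_symm (u v w x : E) : B u v w x = B w x u v := by
  linarith [hB.bianchi u v w x, hB.bianchi v w x u, hB.bianchi w x u v, hB.bianchi x u v w,
    hB.skew u v w x, hB.skew w x u v, hB.skew v w u x, hB.skew x u v w, hB.skew w u v x,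
    hB.skew v x w u, hB.antisymm w u x v, hB.antisymm v x u w, hB.skew u w x v,
    hB.antisymm u w v x, hB.skew x v u w, hB.antisymm x v w u, hB.skew w u x v,
    hB.skew v x u w, hB.skew x u w v, hB.skew v w x u]

theorem add_second (u v v' w x : E) : B u (v + v') w x = B u v w x + B u v' w x := by
  rw [hB.antisymm, hB.add_left, neg_add, ← hB.antisymm, ← hB.antisymm]

theorem add_third (u v w w' x : E) : B u v (w + w') x = B u v w x + B u v w' x := by
  rw [hB.pair_symm, hB.add_left, hB.pair_symm w, hB.pair_symm w']

theorem add_fourth (u v w x x' : E) : B u v w (x + x') = B u v w x + B u v w x' := by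
  rw [hB.skew, hB.add_third, neg_add, ← hB.skew, ← hB.skew]

theorem apply_outer_eq_zero (hsec : ∀ u v, B u v v u = 0) (u v w : E) : B u v w u = 0 := by
  have hpolar := hsec u (v + w)
  rw [hB.add_second, hB.add_third, hB.add_third, hsec, hsec] at hpolar
  have hswap : B u w v u = B u v w u := by
    rw [hB.pair_symm, hB.antisymm, hB.skew, neg_neg]
  linarith

/-- Once the sectional values vanish, the form is totally antisymmetric, so that the three terms of
the Bianchi identity are equal. -/
theorem eq_zero (hsec : ∀ u v, B u v v u = 0) (u v w x : E) : B u v w x = 0 := by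
  have houter := hB.apply_outer_eq_zero hsec
  have hexchange : ∀ u v w x, B u v w x = -B x v w u := fun u v w x ↦ by
    have hpolar := houter (u + x) v w
    rw [hB.add_left, hB.add_fourth, hB.add_fourth, houter, houter] at hpolar
    linarith
  have hcyclic : ∀ u v w, B v w u x = B u v w x := fun u v w ↦ by
    rw [hexchange, hB.antisymm, neg_neg, hB.pair_symm]
  linarith [hB.bianchi u v w x, hcyclic u v w, hcyclic v w u]

end IsCurvatureLike

end CurvatureAlgebra

section LocalCurvature

variable {E : Type*} [NormedAddCommGroup E] [NormedSpace ℝ E]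
  {h : E → E →L[ℝ] E →L[ℝ] ℝ} {Γ : E → E →L[ℝ] E →L[ℝ] E} {y : E}

namespace IsLocalMetric

variable (H : IsLocalMetric h Γ y)
include H

theorem localCurvature_bianchi (u v w : E) :
    localCurvature Γ y u v w + localCurvature Γ y v w u + localCurvature Γ y w u v = 0 := by
  have hΓ := H.leviCivita.self_of_nhds.symm
  have hΓ' : ∀ u v w, fderiv ℝ Γ y u v w = fderiv ℝ Γ y u w v := fun u v w ↦ by
    have hsymm : (fun x ↦ Γ x v w) =ᶠ[𝓝 y] fun x ↦ Γ x w v :=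
      H.leviCivita.mono fun x hx ↦ hx.symm v w
    rw [← fderiv_apply_apply H.differentiableAt, hsymm.fderiv_eq,
      fderiv_apply_apply H.differentiableAt]
  simp only [localCurvature]
  rw [hΓ' u w v, hΓ' w v u, hΓ' v w u, hΓ w v, hΓ u w, hΓ v u]
  abel

theorem fderiv_fderiv_apply (u v w x : E) :
    fderiv ℝ (fderiv ℝ h) y u v w x =
      h y (Γ y u (Γ y v w)) x + h y (Γ y v w) (Γ y u x) + h y (fderiv ℝ Γ y u v w) x
      + (h y (Γ y u w) (Γ y v x) + h y w (Γ y u (Γ y v x)) + h y w (fderiv ℝ Γ y u v x)) := by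
  have hdiff := H.contDiffAt.differentiableAt two_ne_zero
  have hdiff' : DifferentiableAt ℝ (fderiv ℝ h) y :=
    (H.contDiffAt.fderiv_right (m := 1) (by norm_num)).differentiableAt one_ne_zero
  have hΓ : ∀ v w, DifferentiableAt ℝ (fun x ↦ Γ x v w) y := fun v w ↦
    (H.differentiableAt.clm_apply (differentiableAt_const v)).clm_apply (differentiableAt_const w)
  have hmetric : (fun x' ↦ fderiv ℝ h x' v w x) =ᶠ[𝓝 y]
      fun x' ↦ h x' (Γ x' v w) x + h x' w (Γ x' v x) :=
    H.leviCivita.mono fun x' hx' ↦ hx'.metric v w x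
  have hpair : ∀ {V W : E → E}, DifferentiableAt ℝ V y → DifferentiableAt ℝ W y →
      DifferentiableAt ℝ (fun x' ↦ h x' (V x') (W x')) y := fun hV hW ↦
    (hdiff.clm_apply hV).clm_apply hW
  have hconst : ∀ v : E, DifferentiableAt ℝ (fun _ : E ↦ v) y := differentiableAt_const
  calc fderiv ℝ (fderiv ℝ h) y u v w x
      = fderiv ℝ (fun x' ↦ fderiv ℝ h x' v w x) y u := by
        rw [fderiv_apply_apply (hdiff'.clm_apply (hconst v)), fderiv_clm_apply hdiff' (hconst v)]
        simp
    _ = _ := by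
        rw [hmetric.fderiv_eq,
          fderiv_fun_add (hpair (hΓ v w) (hconst x)) (hpair (hconst w) (hΓ v x)), add_apply,
          fderiv_bilinear_apply hdiff (hΓ v w) (hconst x),
          fderiv_bilinear_apply hdiff (hconst w) (hΓ v x), fderiv_apply_apply H.differentiableAt,
          fderiv_apply_apply H.differentiableAt, H.leviCivita.self_of_nhds.metric,
          H.leviCivita.self_of_nhds.metric, fderiv_fun_const]
        simp

theorem localCurvature_skew (u v w x : E) :
    h y (localCurvature Γ y u v w) x = -h y (localCurvature Γ y u v x) w := by
  have hsymm : fderiv ℝ (fderiv ℝ h) y u v w x = fderiv ℝ (fderiv ℝ h) y v u w x := by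
    rw [(H.contDiffAt.isSymmSndFDerivAt (by simp)).eq u v]
  rw [H.fderiv_fderiv_apply, H.fderiv_fderiv_apply] at hsymm
  rw [H.inner.self_of_nhds.symm (localCurvature Γ y u v x)]
  simp only [localCurvature, map_add, map_sub, add_apply, sub_apply]
  linarith

theorem isCurvatureLike_sub_const (c : ℝ) :
    IsCurvatureLike fun u v w x ↦ h y (localCurvature Γ y u v w) x
      - c * (h y v w * h y u x - h y u w * h y v x) where
  add_left u u' v w x := by
    simp only [localCurvature, map_add, map_sub, add_apply, sub_apply]
    ring
  antisymm u v w x := by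
    simp only [localCurvature, map_add, map_sub, add_apply, sub_apply]
    ring
  skew u v w x := by
    rw [H.localCurvature_skew]
    ring
  bianchi u v w x := by
    have hsymm := H.inner.self_of_nhds.symm
    have hbianchi := congrArg (fun a ↦ h y a x) (H.localCurvature_bianchi u v w)
    simp only [map_add, add_apply, map_zero, zero_apply] at hbianchi
    simp only [hsymm v u, hsymm w u, hsymm w v]
    linarith

theorem sectional_eq_const_iff (c : ℝ) :
    (∀ u v, h y (localCurvature Γ y u v v) u = c * (h y u u * h y v v - h y u v ^ 2)) ↔
      ∀ u v w, localCurvature Γ y u v w = c • (h y v w • u - h y u w • v) := by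
  have hinner := H.inner.self_of_nhds
  constructor
  · intro hsec u v w
    rw [← sub_eq_zero]
    refine hinner.eq_zero_of_forall fun x ↦ ?_
    have hzero := (H.isCurvatureLike_sub_const c).eq_zero
      (fun u v ↦ by rw [hsec, hinner.symm v u]; ring) u v w x
    simpa only [map_sub, map_smul, sub_apply, smul_apply, smul_eq_mul] using hzero
  · intro hR u v
    rw [hR]
    simp only [map_sub, map_smul, sub_apply, smul_apply, smul_eq_mul, hinner.symm v u]
    ring

end IsLocalMetric

end LocalCurvature

section Chart

variable {E : Type*} [NormedAddCommGroup E] [NormedSpace ℝ E] [FiniteDimensional ℝ E]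
  {M : Type*} [TopologicalSpace M] [ChartedSpace E M] [IsManifold 𝓘(ℝ, E) ∞ M]

theorem differentiableAt_christoffel (g : Metric E M) {x : M} {y : E}
    (hy : y ∈ (extChartAt 𝓘(ℝ, E) x).target) : DifferentiableAt ℝ (christoffel g x) y := by
  have hmetric := chartMetric_contDiffAt g hy
  have hinv : DifferentiableAt ℝ (fun y ↦ (chartMetric g x y).inverse) y :=
    (contDiffAt_inverse (chartMetric_isInner g hy) hmetric).differentiableAt (by simp)
  have hderiv : DifferentiableAt ℝ (fderiv ℝ (chartMetric g x)) y :=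
    (hmetric.fderiv_right (m := 1) (by norm_cast)).differentiableAt one_ne_zero
  have hflip : DifferentiableAt ℝ (fun y ↦ (fderiv ℝ (chartMetric g x) y).flip) y :=
    (flipₗᵢ ℝ E E (E →L[ℝ] ℝ)).toContinuousLinearEquiv.differentiableAt.comp y hderiv
  have hfirst : DifferentiableAt ℝ (christoffelFirst g x) y :=
    ((hderiv.add hflip).sub
      ((differentiableAt_const (flipCLM E)).clm_comp hflip)).const_smul (1 / 2 : ℝ)
  exact ((compL ℝ E (E →L[ℝ] ℝ) E).differentiableAt.comp y hinv).clm_comp hfirst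

theorem isLocalMetric_chart (g : Metric E M) {x : M} {y : E}
    (hy : y ∈ (extChartAt 𝓘(ℝ, E) x).target) :
    IsLocalMetric (chartMetric g x) (christoffel g x) y := by
  have hnhds := (isOpen_extChartAt_target (I := 𝓘(ℝ, E)) x).mem_nhds hy
  exact ⟨Filter.mem_of_superset hnhds fun y hy ↦ chartMetric_isInner g hy,
    Filter.mem_of_superset hnhds fun y hy ↦ christoffel_isLeviCivitaAt g hy,
    (chartMetric_contDiffAt g hy).of_le (by norm_cast), differentiableAt_christoffel g hy⟩

theorem curvature_eq_localCurvature (g : Metric E M) (x : M) (u v w : E) :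
    curvature g x u v w = localCurvature (christoffel g x) (extChartAt 𝓘(ℝ, E) x x) u v w := by
  simp only [curvature, localCurvature, christoffelAt,
    fderiv_apply_apply (differentiableAt_christoffel g (mem_extChartAt_target (I := 𝓘(ℝ, E)) x))]

theorem hasConstantSectionalCurvature_iff (g : Metric E M) (c : ℝ) :
    HasConstantSectionalCurvature g c ↔ ∀ (x : M) (u v w : E),
      curvature g x u v w = c • (flat g x v w • u - flat g x u w • v) := by
  refine forall_congr' fun x ↦ ?_
  have hconst := (isLocalMetric_chart g
    (mem_extChartAt_target (I := 𝓘(ℝ, E)) x)).sectional_eq_const_iff c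
  simpa only [← curvature_eq_localCurvature, chartMetric_self] using hconst

end Chart

section CoefficientRelations

theorem SmoothCoeff.continuousOn_coeffDeriv {f : ℝ → ℝ} (hf : SmoothCoeff f) :
    ContinuousOn (coeffDeriv f) (Set.Ici 0) :=
  ContDiffOn.continuousOn_derivWithin hf (uniqueDiffOn_Ici 0) (by norm_cast)

theorem SmoothCoeff.hasDerivWithinAt {f : ℝ → ℝ} (hf : SmoothCoeff f) {t : ℝ} (ht : 0 ≤ t) :
    HasDerivWithinAt f (coeffDeriv f t) (Set.Ici 0) t :=
  ((hf.differentiableOn (by simp)) t ht).hasDerivWithinAt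

theorem eqOn_Ici_of_eqOn_Ioi {X : Type*} [TopologicalSpace X] [T2Space X] {f f' : ℝ → X} {a : ℝ}
    (hf : ContinuousOn f (Set.Ici a)) (hf' : ContinuousOn f' (Set.Ici a))
    (heq : Set.EqOn f f' (Set.Ioi a)) : Set.EqOn f f' (Set.Ici a) :=
  heq.of_subset_closure hf hf' Set.Ioi_subset_Ici_self (closure_Ioi a).ge

theorem ne_zero_of_linear_ode {f f' q : ℝ → ℝ} {a : ℝ} (hq : ContinuousOn q (Set.Ici a))
    (hf : ∀ t, a ≤ t → HasDerivWithinAt f (f' t) (Set.Ici a) t)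
    (hode : ∀ t, a ≤ t → f' t = q t * f t) (ha : f a ≠ 0) {T : ℝ} (hT : a ≤ T) : f T ≠ 0 := by
  intro hfT
  obtain ⟨K, hK⟩ := isCompact_Icc.exists_bound_of_continuousOn
    (hq.mono (Set.Icc_subset_Ici_self : Set.Icc a T ⊆ Set.Ici a))
  have hK0 : 0 ≤ K := (norm_nonneg _).trans (hK a ⟨le_rfl, hT⟩)
  have heq := ODE_solution_unique_of_mem_Icc_left (v := fun t x ↦ q t * x)
    (s := fun _ ↦ Set.univ) (f := f) (g := fun _ ↦ 0) (a := a) (b := T) (K := ⟨K, hK0⟩)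
    (fun t ht ↦ ?_) (fun t ht ↦ ?_) (fun t ht ↦ ?_) (fun _ _ ↦ Set.mem_univ _)
    continuousOn_const (fun _ _ ↦ ?_) (fun _ _ ↦ Set.mem_univ _) hfT
  · exact ha (heq ⟨le_rfl, hT⟩)
  · refine LipschitzOnWith.of_dist_le_mul fun x _ y _ ↦ ?_
    rw [Real.dist_eq, Real.dist_eq, ← mul_sub, abs_mul]
    exact mul_le_mul_of_nonneg_right (hK t ⟨ht.1.le, ht.2⟩) (abs_nonneg _)
  · exact ((hf t ht.1).continuousWithinAt).mono Set.Icc_subset_Ici_self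
  · rw [← hode t ht.1.le]
    exact ((hf t ht.1.le).hasDerivAt (Ici_mem_nhds ht.1)).hasDerivWithinAt
  · rw [mul_zero]
    exact hasDerivWithinAt_const _ _ _

variable {a₁ b₁ a₂ b₂ c₁ d₁ c₂ d₂ : ℝ → ℝ}

theorem continuousOn_radialCoeff (ha : SmoothCoeff a₁) (hb : SmoothCoeff b₁) :
    ContinuousOn (fun t ↦ a₁ t + 2 * t * b₁ t) (Set.Ici 0) :=
  (ContDiffOn.continuousOn ha).add
    ((continuousOn_const.mul continuousOn_id).mul (ContDiffOn.continuousOn hb))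

theorem continuousOn_nijenhuisCoeff (ha₁ : SmoothCoeff a₁) (hb₁ : SmoothCoeff b₁) :
    ContinuousOn (nijenhuisCoeff a₁ b₁) (Set.Ici 0) :=
  ((ContDiffOn.continuousOn ha₁).mul (ContDiffOn.continuousOn hb₁)).sub
    (ha₁.continuousOn_coeffDeriv.mul (continuousOn_radialCoeff ha₁ hb₁))

theorem sub_mul_radialCoeff (a₁ b₁ : ℝ → ℝ) (t : ℝ) :
    (a₁ t - 2 * t * coeffDeriv a₁ t) * (a₁ t + 2 * t * b₁ t) =
      a₁ t ^ 2 + 2 * nijenhuisCoeff a₁ b₁ t * t := by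
  rw [nijenhuisCoeff]
  ring

/-- The function `a₁² + 2ct` solves a linear differential equation with coefficient
`2 b₁ / (a₁ + 2t b₁)`. -/
theorem sq_add_ne_zero_of_nijenhuisCoeff_eq_const (ha₁ : SmoothCoeff a₁) (hb₁ : SmoothCoeff b₁)
    {c : ℝ} (hk : ∀ t, 0 ≤ t → nijenhuisCoeff a₁ b₁ t = c)
    (hradial : ∀ t, 0 ≤ t → a₁ t + 2 * t * b₁ t ≠ 0) {t : ℝ} (ht : 0 ≤ t) :
    a₁ t ^ 2 + 2 * c * t ≠ 0 := by
  refine ne_zero_of_linear_ode (f := fun t ↦ a₁ t ^ 2 + 2 * c * t)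
    (f' := fun t ↦ 2 * a₁ t * coeffDeriv a₁ t + 2 * c)
    (q := fun t ↦ 2 * b₁ t / (a₁ t + 2 * t * b₁ t))
    ((continuousOn_const.mul (ContDiffOn.continuousOn hb₁)).div
      (continuousOn_radialCoeff ha₁ hb₁) hradial) (fun t ht ↦ ?_) (fun t ht ↦ ?_) ?_ ht
  · refine (((ha₁.hasDerivWithinAt ht).pow 2).add
      ((hasDerivWithinAt_id t (Set.Ici 0)).const_mul (2 * c))).congr_deriv ?_
    simp
  · rw [← hk t ht, ← sub_mul_radialCoeff, div_mul_eq_mul_div, eq_div_iff (hradial t ht),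
      nijenhuisCoeff]
    ring
  · simpa using hradial 0 le_rfl

namespace ParaHermitianRelations

variable (hrel : ∀ t, 0 ≤ t → ParaHermitianRelations a₁ b₁ a₂ b₂ c₁ d₁ c₂ d₂ t)
include hrel

theorem mul_radial_eq_neg_mul (ha₁ : SmoothCoeff a₁) (hb₁ : SmoothCoeff b₁)
    (ha₂ : SmoothCoeff a₂) (hb₂ : SmoothCoeff b₂) {t : ℝ} (ht : 0 ≤ t) :
    b₂ t * (a₁ t + 2 * t * b₁ t) = -(b₁ t * a₂ t) := by
  refine eqOn_Ici_of_eqOn_Ioi (f := fun t ↦ b₂ t * (a₁ t + 2 * t * b₁ t))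
    (f' := fun t ↦ -(b₁ t * a₂ t))
    ((ContDiffOn.continuousOn hb₂).mul (continuousOn_radialCoeff ha₁ hb₁))
    ((ContDiffOn.continuousOn hb₁).mul (ContDiffOn.continuousOn ha₂)).neg (fun t ht ↦ ?_) ht
  refine mul_left_cancel₀ (mul_pos two_pos ht).ne' ?_
  linear_combination (hrel t (le_of_lt ht)).mul_radial - (hrel t (le_of_lt ht)).mul_orth

theorem coeffDeriv_mul_add_mul_coeffDeriv (ha₁ : SmoothCoeff a₁) (ha₂ : SmoothCoeff a₂) {t : ℝ}
    (ht : 0 ≤ t) : coeffDeriv a₁ t * a₂ t + a₁ t * coeffDeriv a₂ t = 0 := by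
  have hconst : HasDerivWithinAt (a₁ * a₂) 0 (Set.Ici 0) t :=
    (hasDerivWithinAt_const t (Set.Ici 0) (1 : ℝ)).congr
      (fun s hs ↦ (hrel s hs).mul_orth) (hrel t ht).mul_orth
  exact (uniqueDiffOn_Ici (0 : ℝ) t ht).eq_deriv _
    ((ha₁.hasDerivWithinAt ht).mul (ha₂.hasDerivWithinAt ht)) hconst

theorem nijenhuisCoeff_eq_const_iff (ha₁ : SmoothCoeff a₁) (hb₁ : SmoothCoeff b₁)
    (ha₂ : SmoothCoeff a₂) (hb₂ : SmoothCoeff b₂) (c : ℝ) :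
    (∀ t, 0 ≤ t → nijenhuisCoeff a₁ b₁ t = c) ↔ IntegrabilityRelations a₁ b₁ a₂ b₂ c := by
  refine ⟨fun hk t ht ↦ ?_, fun h t ht ↦ ?_⟩
  · have horth := (hrel t ht).mul_orth
    have hb₁' : b₁ t * (a₁ t - 2 * t * coeffDeriv a₁ t) = a₁ t * coeffDeriv a₁ t + c := by
      rw [← hk t ht, nijenhuisCoeff]
      ring
    have hfactor := sub_mul_radialCoeff a₁ b₁ t
    rw [hk t ht] at hfactor
    have hne := sq_add_ne_zero_of_nijenhuisCoeff_eq_const ha₁ hb₁ hk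
      (fun s hs ↦ left_ne_zero_of_mul_eq_one (hrel s hs).mul_radial) ht
    have hdenom₁ : a₁ t - 2 * t * coeffDeriv a₁ t ≠ 0 := left_ne_zero_of_mul (hfactor ▸ hne)
    have hdenom : a₁ t + 2 * c * t * a₂ t = a₂ t * (a₁ t ^ 2 + 2 * c * t) := by
      linear_combination (-a₁ t) * horth
    have hdenom₂ : a₁ t + 2 * c * t * a₂ t ≠ 0 :=
      hdenom ▸ mul_ne_zero (right_ne_zero_of_mul_eq_one horth) hne
    refine ⟨hdenom₁, hdenom₂, by rw [eq_div_iff hdenom₁, hb₁'], ?_⟩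
    rw [eq_div_iff hdenom₂, hdenom, ← hfactor]
    linear_combination (a₂ t * (a₁ t - 2 * t * coeffDeriv a₁ t))
        * mul_radial_eq_neg_mul hrel ha₁ hb₁ ha₂ hb₂ ht
      - a₂ t ^ 2 * hb₁' - a₁ t * a₂ t * coeffDeriv_mul_add_mul_coeffDeriv hrel ha₁ ha₂ ht
      + a₁ t * coeffDeriv a₂ t * horth
  · obtain ⟨hdenom₁, -, hb₁', -⟩ := h t ht
    rw [eq_div_iff hdenom₁] at hb₁'
    rw [nijenhuisCoeff]
    linear_combination hb₁'

end ParaHermitianRelations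

end CoefficientRelations

section TestVectors

variable {E : Type*} [NormedAddCommGroup E] [NormedSpace ℝ E] [FiniteDimensional ℝ E]
  {h : E →L[ℝ] E →L[ℝ] ℝ} (hn : 2 ≤ Module.finrank ℝ E) (hh : IsInner h)

omit [FiniteDimensional ℝ E] in
theorem halfSq_smul (h : E →L[ℝ] E →L[ℝ] ℝ) (s : ℝ) (ξ : E →L[ℝ] ℝ) :
    halfSq h (s • ξ) = s ^ 2 * halfSq h ξ := by
  simp only [halfSq, map_smul, smul_apply, smul_eq_mul]
  ring

include hn hh

/-- The left-hand side of the hypothesis is linear in `ξ`, so rescaling a covector of energy `1` to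
energy `t` does not change the coefficient. -/
theorem IsInner.coeff_eq_coeff_one {R : E → E → E → E} {k : ℝ → ℝ}
    (hR : ∀ (ξ : E →L[ℝ] ℝ) (u v w : E), ξ (R u v w) =
      k (halfSq h ξ) * (ξ u * h v w - ξ v * h u w)) {t : ℝ} (ht : 0 < t) : k t = k 1 := by
  have : Nontrivial E := Module.nontrivial_of_finrank_pos (R := ℝ) (by omega)
  obtain ⟨ξ, hξ⟩ := hh.exists_halfSq_eq zero_le_one
  obtain ⟨v, hv, hξv⟩ := exists_ne_zero_apply_eq_zero hn ξ
  have hscaled : halfSq h (√t • ξ) = t := by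
    rw [halfSq_smul, hξ, Real.sq_sqrt ht.le, mul_one]
  have hξt := hR (√t • ξ) (h.inverse ξ) v v
  simp only [smul_apply, smul_eq_mul, hscaled, hR ξ, hξv, apply_inverse_self, hξ] at hξt
  have hne : √t * (2 * h v v) ≠ 0 := by
    have hpos := hh.pos v hv
    positivity
  exact mul_right_cancel₀ hne (by linarith)

theorem exists_vertForm_wedge_canonicalForm_ne_zero (Γ : E →L[ℝ] E →L[ℝ] E) {ξ : E →L[ℝ] ℝ}
    (hξ : 0 < halfSq h ξ) :
    ∃ u v w : E × (E →L[ℝ] ℝ), vertForm h Γ ξ u * canonicalForm E v w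
      - vertForm h Γ ξ v * canonicalForm E u w + vertForm h Γ ξ w * canonicalForm E u v ≠ 0 := by
  obtain ⟨v, hv, hξv⟩ := exists_ne_zero_apply_eq_zero hn ξ
  refine ⟨(0, ξ), (v, connForm Γ ξ v), (0, h v), ?_⟩
  have hpos := hh.pos v hv
  simp only [vertForm_apply, canonicalForm_apply, map_zero, sub_zero, sub_self, zero_apply,
    mul_zero, hξv, add_zero, apply_inverse_self]
  positivity

end TestVectors

section Global

variable {E : Type*} [NormedAddCommGroup E] [NormedSpace ℝ E]
  {M : Type*} [TopologicalSpace M] [ChartedSpace E M] [IsManifold 𝓘(ℝ, E) ∞ M]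
  {a₁ b₁ a₂ b₂ c₁ d₁ c₂ d₂ lam mu : ℝ → ℝ}

theorem cotangent_extChartAt_self (p : CotangentBundle E M) :
    extChartAt (cotangentModel E) p p = (extChartAt 𝓘(ℝ, E) p.proj p.proj, covector p) := by
  rw [cotangent_extChartAt_apply (mem_extChartAt_source _), coordFrame_self]
  rfl

variable [FiniteDimensional ℝ E] {g : Metric E M}

theorem forall_nijenhuis_naturalTensor_eq_zero_iff (ha₁ : SmoothCoeff a₁) (hb₁ : SmoothCoeff b₁)
    (ha₂ : SmoothCoeff a₂) (hb₂ : SmoothCoeff b₂)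
    (hP : IsAlmostProduct (cotangentModel E) (naturalTensor g a₁ b₁ a₂ b₂))
    (p : CotangentBundle E M) :
    (∀ V W : ∀ q : CotangentBundle E M, TangentSpace (cotangentModel E) q,
      SmoothFieldAt (cotangentModel E) V p → SmoothFieldAt (cotangentModel E) W p →
        nijenhuis (cotangentModel E) (naturalTensor g a₁ b₁ a₂ b₂) V W p = 0) ↔
      ∀ u v w : E, covector p (curvature g p.proj u v w) =
        nijenhuisCoeff a₁ b₁ (halfSq (flat g p.proj) (covector p)) *
          (covector p u * flat g p.proj v w - covector p v * flat g p.proj u w) := by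
  have : CompleteSpace (E × (E →L[ℝ] ℝ)) := FiniteDimensional.complete ℝ _
  have hcoord := isCoordTensor_naturalTensor g a₁ b₁ a₂ b₂ p
  have hJJ := hcoord.eventually_apply_apply hP
  have H := isLocalMetric_chart g (mem_extChartAt_target (I := 𝓘(ℝ, E)) p.proj)
  have hdiff := IsLocalMetric.differentiableAt_localTensor (z := (_, covector p)) H ha₁ hb₁ ha₂ hb₂
  rw [← cotangent_extChartAt_self] at hdiff
  rw [nijenhuis_eq_zero_iff hdiff hcoord]
  rw [cotangent_extChartAt_self] at hJJ ⊢
  rw [IsLocalMetric.coordNijenhuis_localTensor_eq_zero_iff H ha₁ hb₁ ha₂ hb₂ hJJ]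
  simp only [localEnergy, chartMetric_self, ← curvature_eq_localCurvature]

theorem isLocallyProduct_iff_curvature (ha₁ : SmoothCoeff a₁) (hb₁ : SmoothCoeff b₁)
    (ha₂ : SmoothCoeff a₂) (hb₂ : SmoothCoeff b₂)
    (hP : IsAlmostProduct (cotangentModel E) (naturalTensor g a₁ b₁ a₂ b₂)) :
    IsLocallyProduct (cotangentModel E) (naturalTensor g a₁ b₁ a₂ b₂) ↔
      ∀ (x : M) (ξ : E →L[ℝ] ℝ) (u v w : E), ξ (curvature g x u v w) =
        nijenhuisCoeff a₁ b₁ (halfSq (flat g x) ξ) *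
          (ξ u * flat g x v w - ξ v * flat g x u w) := by
  have hpoint := forall_nijenhuis_naturalTensor_eq_zero_iff ha₁ hb₁ ha₂ hb₂ hP
  exact ⟨fun h x ξ ↦ (hpoint ⟨x, ξ⟩).1 (h.2 ⟨x, ξ⟩),
    fun h ↦ ⟨hP, fun p ↦ (hpoint p).2 (h p.proj (covector p))⟩⟩

theorem hasConstantSectionalCurvature_iff_covector (g : Metric E M) (c : ℝ) :
    HasConstantSectionalCurvature g c ↔ ∀ (x : M) (ξ : E →L[ℝ] ℝ) (u v w : E),
      ξ (curvature g x u v w) = c * (ξ u * flat g x v w - ξ v * flat g x u w) := by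
  rw [hasConstantSectionalCurvature_iff]
  refine forall_congr' fun x ↦ ⟨fun h ξ u v w ↦ ?_, fun h u v w ↦ ?_⟩
  · rw [h, map_smul, map_sub, map_smul, map_smul, smul_eq_mul, smul_eq_mul, smul_eq_mul,
      mul_comm (ξ u), mul_comm (ξ v)]
  · refine SeparatingDual.eq_iff_forall_dual_eq (R := ℝ) |>.2 fun ξ ↦ ?_
    rw [h, map_smul, map_sub, map_smul, map_smul, smul_eq_mul, smul_eq_mul, smul_eq_mul,
      mul_comm (ξ u), mul_comm (ξ v)]

theorem curvature_eq_coeff_mul_iff [Nonempty M] (hn : 2 ≤ Module.finrank ℝ E) (g : Metric E M)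
    {k : ℝ → ℝ} (hk : ContinuousOn k (Set.Ici 0)) :
    (∀ (x : M) (ξ : E →L[ℝ] ℝ) (u v w : E), ξ (curvature g x u v w) =
      k (halfSq (flat g x) ξ) * (ξ u * flat g x v w - ξ v * flat g x u w)) ↔
      ∃ c, HasConstantSectionalCurvature g c ∧ ∀ t, 0 ≤ t → k t = c := by
  simp only [hasConstantSectionalCurvature_iff_covector]
  constructor
  · intro h
    obtain ⟨x⟩ := ‹Nonempty M›
    have hconst : ∀ t, 0 ≤ t → k t = k 1 := fun t ht ↦
      eqOn_Ici_of_eqOn_Ioi hk continuousOn_const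
        (fun t ht ↦ (flat_isInner g x).coeff_eq_coeff_one hn (h x) ht) ht
    exact ⟨k 1, fun y ξ u v w ↦ by rw [h, hconst _ ((flat_isInner g y).halfSq_nonneg ξ)], hconst⟩
  · rintro ⟨c, hc, hkc⟩ x ξ u v w
    rw [hc, hkc _ ((flat_isInner g x).halfSq_nonneg ξ)]

theorem isLocallyProduct_iff_constant_curvature [Nonempty M] (hn : 2 ≤ Module.finrank ℝ E)
    (ha₁ : SmoothCoeff a₁) (hb₁ : SmoothCoeff b₁) (ha₂ : SmoothCoeff a₂) (hb₂ : SmoothCoeff b₂)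
    (hP : IsAlmostProduct (cotangentModel E) (naturalTensor g a₁ b₁ a₂ b₂))
    (hrel : ∀ t, 0 ≤ t → ParaHermitianRelations a₁ b₁ a₂ b₂ c₁ d₁ c₂ d₂ t) :
    IsLocallyProduct (cotangentModel E) (naturalTensor g a₁ b₁ a₂ b₂) ↔
      ∃ c : ℝ, HasConstantSectionalCurvature g c ∧ IntegrabilityRelations a₁ b₁ a₂ b₂ c := by
  rw [isLocallyProduct_iff_curvature ha₁ hb₁ ha₂ hb₂ hP,
    curvature_eq_coeff_mul_iff hn g (continuousOn_nijenhuisCoeff ha₁ hb₁)]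
  simp only [ParaHermitianRelations.nijenhuisCoeff_eq_const_iff hrel ha₁ hb₁ ha₂ hb₂]

theorem forall_extDerivTwoForm_associatedForm_eq_zero_iff
    (hrel : ∀ t, 0 ≤ t → ParaHermitianRelations a₁ b₁ a₂ b₂ c₁ d₁ c₂ d₂ t)
    (hf : AreProportionalityFactors a₁ b₁ a₂ b₂ c₁ d₁ c₂ d₂ lam mu) (p : CotangentBundle E M) :
    (∀ U V W : ∀ q : CotangentBundle E M, TangentSpace (cotangentModel E) q,
      SmoothFieldAt (cotangentModel E) U p → SmoothFieldAt (cotangentModel E) V p →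
      SmoothFieldAt (cotangentModel E) W p → extDerivTwoForm (cotangentModel E)
        (associatedForm (cotangentModel E) (naturalMetric g c₁ d₁ c₂ d₂)
          (naturalTensor g a₁ b₁ a₂ b₂)) U V W p = 0) ↔
      ∀ u v w : E × (E →L[ℝ] ℝ), (coeffDeriv lam (halfSq (flat g p.proj) (covector p))
          - mu (halfSq (flat g p.proj) (covector p))) *
        (vertForm (flat g p.proj) (christoffelAt g p.proj) (covector p) u * canonicalForm E v w
        - vertForm (flat g p.proj) (christoffelAt g p.proj) (covector p) v * canonicalForm E u w
        + vertForm (flat g p.proj) (christoffelAt g p.proj) (covector p) w *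
          canonicalForm E u v) = 0 := by
  have : CompleteSpace (E × (E →L[ℝ] ℝ)) := FiniteDimensional.complete ℝ _
  have H := isLocalMetric_chart g (mem_extChartAt_target (I := 𝓘(ℝ, E)) p.proj)
  obtain ⟨hdiff, hderiv⟩ := IsLocalMetric.coordExtDeriv_localForm (z := (_, covector p)) H
    hf.smooth_lam hf.smooth_mu
  rw [← cotangent_extChartAt_self] at hdiff
  rw [extDerivTwoForm_eq_zero_iff hdiff (localForm_antisymm _ _ lam mu _)
    (isCoordForm_associatedForm g hrel hf p), cotangent_extChartAt_self]
  simp only [hderiv, localEnergy, chartMetric_self, christoffelAt]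

theorem isClosedTwoForm_associatedForm_iff [Nonempty M] (hn : 2 ≤ Module.finrank ℝ E)
    (g : Metric E M)
    (hrel : ∀ t, 0 ≤ t → ParaHermitianRelations a₁ b₁ a₂ b₂ c₁ d₁ c₂ d₂ t)
    (hf : AreProportionalityFactors a₁ b₁ a₂ b₂ c₁ d₁ c₂ d₂ lam mu) :
    IsClosedTwoForm (cotangentModel E) (associatedForm (cotangentModel E)
      (naturalMetric g c₁ d₁ c₂ d₂) (naturalTensor g a₁ b₁ a₂ b₂)) ↔
      ∀ t, 0 ≤ t → mu t = coeffDeriv lam t := by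
  have hpoint := forall_extDerivTwoForm_associatedForm_eq_zero_iff (g := g) hrel hf
  constructor
  · intro h t ht
    refine eqOn_Ici_of_eqOn_Ioi (ContDiffOn.continuousOn hf.smooth_mu)
      hf.smooth_lam.continuousOn_coeffDeriv (fun t ht ↦ ?_) ht
    have : Nontrivial E := Module.nontrivial_of_finrank_pos (R := ℝ) (by omega)
    obtain ⟨x⟩ := ‹Nonempty M›
    obtain ⟨ξ, rfl⟩ := (flat_isInner g x).exists_halfSq_eq (le_of_lt ht)
    obtain ⟨u, v, w, hne⟩ := exists_vertForm_wedge_canonicalForm_ne_zero hn (flat_isInner g x)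
      (christoffelAt g x) ht
    have hzero := (hpoint ⟨x, ξ⟩).1 (h ⟨x, ξ⟩) u v w
    exact (sub_eq_zero.1 ((mul_eq_zero.1 hzero).resolve_right hne)).symm
  · intro h p
    refine (hpoint p).2 fun u v w ↦ ?_
    rw [h _ ((flat_isInner g p.proj).halfSq_nonneg (covector p)), sub_self, zero_mul]

end Global

end ParaKahlerCotangent

end

theorem theorem5p2
    {E : Type*} [NormedAddCommGroup E] [NormedSpace ℝ E] [FiniteDimensional ℝ E]
    {M : Type*} [TopologicalSpace M] [ChartedSpace E M] [IsManifold 𝓘(ℝ, E) ∞ M] [Nonempty M]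
    (hn : 2 ≤ Module.finrank ℝ E)
    (g : Metric E M)
    (a₁ b₁ a₂ b₂ c₁ d₁ c₂ d₂ : ℝ → ℝ)
    (ha₁ : SmoothCoeff a₁) (hb₁ : SmoothCoeff b₁)
    (ha₂ : SmoothCoeff a₂) (hb₂ : SmoothCoeff b₂)
    (hc₁ : SmoothCoeff c₁) (hd₁ : SmoothCoeff d₁)
    (hc₂ : SmoothCoeff c₂) (hd₂ : SmoothCoeff d₂)
    (hGP : IsAlmostParaHermitian (cotangentModel E)
      (naturalMetric g c₁ d₁ c₂ d₂)
      (naturalTensor g a₁ b₁ a₂ b₂)) :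
    (∃ lam mu : ℝ → ℝ,
      AreProportionalityFactors a₁ b₁ a₂ b₂ c₁ d₁ c₂ d₂ lam mu) ∧
    ∀ lam mu : ℝ → ℝ,
      AreProportionalityFactors a₁ b₁ a₂ b₂ c₁ d₁ c₂ d₂ lam mu →
      (IsParaKahler (cotangentModel E)
          (naturalMetric g c₁ d₁ c₂ d₂)
          (naturalTensor g a₁ b₁ a₂ b₂) ↔
        IsLocallyProduct (cotangentModel E)
            (naturalTensor g a₁ b₁ a₂ b₂) ∧
          ∀ t, 0 ≤ t → mu t = coeffDeriv lam t) ∧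
      (IsLocallyProduct (cotangentModel E)
          (naturalTensor g a₁ b₁ a₂ b₂) ↔
        ∃ c : ℝ, HasConstantSectionalCurvature g c ∧
          IntegrabilityRelations a₁ b₁ a₂ b₂ c) := by
  have hrel := fun t (ht : 0 ≤ t) ↦ paraHermitianRelations hn g hGP ht
  refine ⟨exists_proportionalityFactors ha₁ hb₁ hc₁ hd₁ hrel, fun lam mu hf ↦ ⟨?_,
    isLocallyProduct_iff_constant_curvature hn ha₁ hb₁ ha₂ hb₂ hGP.almostProduct hrel⟩⟩
  have hclosed := isClosedTwoForm_associatedForm_iff hn g hrel hf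
  exact ⟨fun h ↦ ⟨h.2, hclosed.1 h.1.2⟩, fun h ↦ ⟨⟨hGP, hclosed.2 h.2⟩, h.1⟩⟩
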